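/- Let $\Delta=\sum_{m\geqslant 0} q^{(2m+1)^2}\in\mathbf F_2[[q]]$ (the reduction modulo $2$ of $q\prod_{n\geqslant 1}(1-q^n)^{24}$). A modular form modulo $2$ of level $1$ is a polynomial in $\Delta$ with coefficients in $\mathbf F_2$, regarded as a power series in $q$. For an odd prime $p$, the Hecke operator $T_p$ sends $f=\sum_{n\geqslant 0} c(n)q^n$ to $T_p|f=\sum_{n\geqslant 0}\gamma(n)q^n$, where $\gamma(n)=c(pn)$ if $p\nmid n$ and $\gamma(n)=c(pn)+c(n/p)$ if $p\mid n$. The order of nilpotence $g(f)$ of a nonzero modular form $f\in\mathbf F_2[\Delta]$ is the smallest integer $g\geqslant 0$ such that $T_{p_1}T_{p_2}\cdots T_{p_g}|f=0$ for every sequence $p_1,\dots,p_g$ of $g$ odd primes, not necessarily distinct (with the convention $g(0)=-\infty$). Let $f\in\mathbf F_2[\Delta]$ be a modular form modulo $2$, parabolic or not, of degree $d\geqslant 1$ in $\Delta$. Then $g(f)$ exists (is finite) and $$g(f)<\tfrac32\sqrt d.$$ -/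

import Mathlib

open scoped Classical in
/-- The formal power series `Δ = ∑_{m ≥ 0} q ^ ((2 m + 1) ^ 2)` with coefficients in `𝔽₂`, which is
the reduction modulo 2 of the discriminant series `q ∏_{n ≥ 1} (1 - q ^ n) ^ 24`. -/
noncomputable def DeltaMod2 : PowerSeries (ZMod 2) :=
  PowerSeries.mk fun n => if ∃ m : ℕ, n = (2 * m + 1) ^ 2 then 1 else 0

/-- The modular form modulo 2 of level 1 given by a polynomial `P` over `𝔽₂`: the power series
`P(Δ)`. Its degree in `Δ` is the degree of `P`. -/
noncomputable def formMod2 (P : Polynomial (ZMod 2)) : PowerSeries (ZMod 2) :=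
  Polynomial.aeval DeltaMod2 P

/-- The Hecke operator `T_p`, for `p` an odd prime, on `q`-expansions modulo 2: the coefficient of
`q ^ n` in `T_p f` is `c (p n)` if `p ∤ n`, and `c (p n) + c (n / p)` if `p ∣ n`. -/
noncomputable def heckeT (p : ℕ) (f : PowerSeries (ZMod 2)) : PowerSeries (ZMod 2) :=
  PowerSeries.mk fun n =>
    if p ∣ n then PowerSeries.coeff (p * n) f + PowerSeries.coeff (n / p) f
    else PowerSeries.coeff (p * n) f

/-- Every product `T_{p₁} T_{p₂} ⋯ T_{p_g}` of `g` Hecke operators attached to odd primes, not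
necessarily distinct, kills `f`. -/
def KilledByHecke (f : PowerSeries (ZMod 2)) (g : ℕ) : Prop :=
  ∀ l : List ℕ, l.length = g → (∀ p ∈ l, p.Prime ∧ Odd p) → l.foldr heckeT f = 0

/-- `g` is the order of nilpotence of `f`: the least `g` such that every product of `g` Hecke
operators attached to odd primes kills `f`. By convention the order of nilpotence of `0` is `-∞`,
so no natural number is the order of nilpotence of `0`. -/
def IsNilpotenceOrder (f : PowerSeries (ZMod 2)) (g : ℕ) : Prop :=
  f ≠ 0 ∧ IsLeast {n : ℕ | KilledByHecke f n} g

/-!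
# Nilpotence of Hecke operators modulo two: the bound `g(f) < (3 / 2) √d`

The proof follows the ideas of Nicolas and Serre.

Every polynomial `P` over `𝔽₂` is `X ψ ^ 2 + ρ ^ 2`, and Hecke operators commute with squaring, so
by induction on the degree it suffices to treat the odd forms `Δ φ(Δ) ^ 2`
(`killedByHecke_of_height_lt`). The exponent `2 j + 1` of `Δ` corresponds to the exponent `j` of
`φ`. The binary digits of `j` of even and of odd rank are the digits of two numbers `codeA j` and
`codeB j`, and `height j` is their sum. It is shown that each Hecke operator lowers the height of an
odd form by at least one (`HeightLT.heckeT`); hence `height j + 1` operators kill `Δ ^ (2 j + 1)`,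
and `4 (height j + 1) ^ 2 < 9 (2 j + 1)` (`four_mul_height_add_one_sq_lt`) gives the bound.

*The operators `T_3` and `T_5`.* The series `T_p Δ ^ k` satisfy a linear recurrence in `k` of order
`p + 1` (`exists_recurrence`), which a few initial values determine for `p = 3` and `p = 5`. Its
characteristic equation is the one satisfied by `y = Δ + u`, where `u ^ 4 = Δ u + Δ ^ 2` for `p = 3`
and `u ^ 6 = Δ u + Δ ^ 2` for `p = 5`. Thus `T_p φ(Δ)` is `Δ` times the last coordinate of
`φ(Δ + u)` in the basis of powers of `u`, and on an odd form `Δ φ(Δ) ^ 2` the operators `T_3` and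
`T_5` replace `φ` by `coord3 1 φ` and `coord5 2 φ` (`heckeT_three_odd`, `heckeT_five_odd`). The
effect of these two coordinates on leading monomials, for the lexicographic order on
`(height, codeB)`, is computed by induction on the base four digits of the exponent (`dominated3`,
`dominated5`): the first one lowers `codeA` by one, the second one lowers `codeB` by one.

*The other operators.* For any odd prime `p` the operator `T_p` acts on odd forms, commutes with
`T_3` and `T_5`, and kills `Δ`. If `φ` has height `n`, then by induction on `n` both `T_3` and `T_5`
send `T_p φ` to height less than `n - 1`; as one of them lowers the height of a non-constant
polynomial by exactly one (`exists_height_coord`), `T_p φ` has height less than `n`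
(`HeightLT.map_of_commute`).

*Modular forms.* That `T_p Δ ^ k` is a polynomial in `Δ` of degree at most `k` comes from
characteristic zero (`exists_heckeT_Delta_pow`): `T_p` preserves forms of level one and weight
`12 k`, and a form of that weight with integral `q`-expansion reduces to such a polynomial, because
`E₄` is `1` modulo two and forms vanishing at the cusp are divisible by the discriminant. The
identity `1728 Δ = E₄ ^ 3 - E₆ ^ 2` shows that the discriminant reduces to `∑ q ^ ((2 m + 1) ^ 2)`
(`map_discSeries_two`).
-/

namespace HeckeMod2

open Polynomial

/-! ### The code of an exponent -/

/-- The number whose `i`-th binary digit is the binary digit of weight `2 ^ (2 i)` of `n`. -/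
def codeA (n : ℕ) : ℕ :=
  if h : n = 0 then 0 else 2 * codeA (n / 4) + n % 2
decreasing_by omega

/-- The number whose `i`-th binary digit is the binary digit of weight `2 ^ (2 i + 1)` of `n`. -/
def codeB (n : ℕ) : ℕ :=
  if h : n = 0 then 0 else 2 * codeB (n / 4) + n / 2 % 2
decreasing_by omega

/-- The height of the exponent `n`; every product of `height n + 1` Hecke operators kills the odd
power `Δ ^ (2 n + 1)`. -/
def height (n : ℕ) : ℕ := codeA n + codeB n

lemma codeA_rec (n : ℕ) : codeA n = 2 * codeA (n / 4) + n % 2 := by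
  rcases eq_or_ne n 0 with rfl | h
  · simp [codeA]
  · rw [codeA, dif_neg h]

lemma codeB_rec (n : ℕ) : codeB n = 2 * codeB (n / 4) + n / 2 % 2 := by
  rcases eq_or_ne n 0 with rfl | h
  · simp [codeB]
  · rw [codeB, dif_neg h]

lemma codeA_four_mul_add (n : ℕ) {s : ℕ} (hs : s < 4) :
    codeA (4 * n + s) = 2 * codeA n + s % 2 := by
  rw [codeA_rec, show (4 * n + s) / 4 = n by omega]
  omega

lemma codeB_four_mul_add (n : ℕ) {s : ℕ} (hs : s < 4) :
    codeB (4 * n + s) = 2 * codeB n + s / 2 := by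
  rw [codeB_rec, show (4 * n + s) / 4 = n by omega]
  omega

lemma codeA_zero : codeA 0 = 0 := by simp [codeA]

lemma codeB_zero : codeB 0 = 0 := by simp [codeB]

/-- The pair of codes determines the exponent. -/
lemma eq_of_code_eq : ∀ {m n : ℕ}, codeA m = codeA n → codeB m = codeB n → m = n := by
  intro m
  induction m using Nat.strong_induction_on with
  | _ m ih =>
    intro n hA hB
    rw [codeA_rec m, codeA_rec n] at hA
    rw [codeB_rec m, codeB_rec n] at hB
    rcases Nat.eq_zero_or_pos m with rfl | hm
    · by_contra hn
      have hn' : 0 < n := by omega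
      clear ih
      have key : ∀ k : ℕ, 0 < k → 0 < codeA k + codeB k := by
        intro k
        induction k using Nat.strong_induction_on with
        | _ k ihk =>
          intro hk
          rw [codeA_rec k, codeB_rec k]
          by_cases h4 : 0 < k / 4
          · have := ihk (k / 4) (by omega) h4
            omega
          · omega
      have := key n hn'
      rw [codeA_rec n, codeB_rec n] at this
      simp only [Nat.zero_div, codeA_zero, codeB_zero] at hA hB
      omega
    · have := ih (m / 4) (by omega) (n := n / 4) (by omega) (by omega)
      omega

lemma eq_zero_of_height_eq_zero {n : ℕ} (h : height n = 0) : n = 0 := by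
  unfold height at h
  exact eq_of_code_eq (by rw [codeA_zero]; omega) (by rw [codeB_zero]; omega)

/-- Adding `1` to an exponent either increases `codeA` by `1` or causes a carry, which strictly
decreases `height` below the value without carry. -/
lemma height_succ (n : ℕ) : height (n + 1) < height n + 1 ∨
    height (n + 1) = height n + 1 ∧ codeB (n + 1) = codeB n := by
  unfold height
  induction n using Nat.strong_induction_on with
  | _ n ih =>
    obtain ⟨k, s, hs, rfl⟩ : ∃ k s, s < 4 ∧ n = 4 * k + s := ⟨n / 4, n % 4, by omega, by omega⟩
    rw [codeA_four_mul_add k hs, codeB_four_mul_add k hs]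
    by_cases h3 : s = 3
    · subst h3
      rw [show 4 * k + 3 + 1 = 4 * (k + 1) + 0 by ring, codeA_four_mul_add _ (by norm_num),
        codeB_four_mul_add _ (by norm_num)]
      have := ih k (by omega)
      omega
    · rw [show 4 * k + s + 1 = 4 * k + (s + 1) by ring, codeA_four_mul_add _ (by omega),
        codeB_four_mul_add _ (by omega)]
      omega

lemma code_quadratic_le (n : ℕ) :
    codeA n ^ 2 + 2 * codeA n + 2 * (codeB n ^ 2 + 2 * codeB n) ≤ 3 * n := by
  induction n using Nat.strong_induction_on with
  | _ n ih =>
    rcases Nat.eq_zero_or_pos n with rfl | hn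
    · simp [codeA_zero, codeB_zero]
    obtain ⟨k, s, hs, rfl⟩ : ∃ k s, s < 4 ∧ n = 4 * k + s := ⟨n / 4, n % 4, by omega, by omega⟩
    rw [codeA_four_mul_add k hs, codeB_four_mul_add k hs]
    have := ih k (by omega)
    interval_cases s <;> norm_num <;> nlinarith

/-- The numerical inequality behind the constant `3 / 2`. -/
lemma four_mul_height_add_one_sq_lt (n : ℕ) : 4 * (height n + 1) ^ 2 < 9 * (2 * n + 1) := by
  have h := code_quadratic_le n
  unfold height
  generalize codeA n = a at *
  generalize codeB n = b at *
  zify at *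
  nlinarith [sq_nonneg ((a : ℤ) + 1 - 2 * (b + 1)), Int.natCast_nonneg a, Int.natCast_nonneg b]

/-! ### The filtration of `𝔽₂[X]` by the code of exponents -/

/-- The polynomials all of whose exponents `j` satisfy `(height j, codeB j) ≤ (n, d)` for the
lexicographic order. -/
def Low (n d : ℤ) : Submodule (ZMod 2) (ZMod 2)[X] where
  carrier := {φ | ∀ j, φ.coeff j ≠ 0 →
    (height j : ℤ) < n ∨ (height j : ℤ) = n ∧ (codeB j : ℤ) ≤ d}
  zero_mem' := by simp
  add_mem' := by
    intro φ ψ hφ hψ j hj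
    rw [coeff_add] at hj
    by_cases h : φ.coeff j = 0
    · exact hψ j (by simpa [h] using hj)
    · exact hφ j h
  smul_mem' := by
    intro c φ hφ j hj
    rw [coeff_smul] at hj
    exact hφ j (right_ne_zero_of_smul hj)

lemma mem_low_iff {n d : ℤ} {φ : (ZMod 2)[X]} : φ ∈ Low n d ↔ ∀ j, φ.coeff j ≠ 0 →
    (height j : ℤ) < n ∨ (height j : ℤ) = n ∧ (codeB j : ℤ) ≤ d :=
  Iff.rfl

attribute [irreducible] Low

lemma Low.add {n d : ℤ} {φ ψ : (ZMod 2)[X]} (hφ : φ ∈ Low n d) (hψ : ψ ∈ Low n d) :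
    φ + ψ ∈ Low n d :=
  add_mem hφ hψ

lemma Low.mono {n d N D : ℤ} {φ : (ZMod 2)[X]} (h : φ ∈ Low n d)
    (hND : n < N ∨ n = N ∧ d ≤ D) : φ ∈ Low N D := by
  rw [mem_low_iff] at *
  intro j hj
  have := h j hj
  omega

lemma X_pow_mem_low (j : ℕ) : (X ^ j : (ZMod 2)[X]) ∈ Low (height j) (codeB j) := by
  rw [mem_low_iff]
  intro i hi
  rw [coeff_X_pow] at hi
  obtain rfl : i = j := by by_contra h; simp [h] at hi
  exact Or.inr ⟨rfl, le_rfl⟩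

lemma Low.X_mul {n d : ℤ} {φ : (ZMod 2)[X]} (h : φ ∈ Low n d) : X * φ ∈ Low (n + 1) d := by
  rw [mem_low_iff] at *
  intro j hj
  rcases j with _ | j
  · simp at hj
  · rw [coeff_X_mul] at hj
    have h1 := h j hj
    have h2 := height_succ j
    omega

lemma Low.X_pow_mul {n d : ℤ} {φ : (ZMod 2)[X]} (h : φ ∈ Low n d) (m : ℕ) :
    X ^ m * φ ∈ Low (n + m) d := by
  induction m with
  | zero => simpa using h
  | succ m ih =>
    rw [pow_succ', mul_assoc]
    exact Low.mono (Low.X_mul ih) (by push_cast; omega)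

lemma pow_four_eq_expand (φ : (ZMod 2)[X]) : φ ^ 4 = expand (ZMod 2) 4 φ := by
  rw [show (4 : ℕ) = 2 * 2 by rfl, expand_mul, ZMod.expand_card, ZMod.expand_card, pow_mul]

lemma Low.X_pow_mul_pow_four {n d N D : ℤ} {φ : (ZMod 2)[X]} (h : φ ∈ Low n d) (e : ℕ)
    (hND : 2 * (n + (e / 4 : ℕ)) + (e % 4 % 2 + e % 4 / 2 : ℕ) < N ∨
      2 * (n + (e / 4 : ℕ)) + (e % 4 % 2 + e % 4 / 2 : ℕ) = N ∧ 2 * d + (e % 4 / 2 : ℕ) ≤ D) :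
    X ^ e * φ ^ 4 ∈ Low N D := by
  rw [show X ^ e * φ ^ 4 = X ^ (e % 4) * (X ^ (e / 4) * φ) ^ 4 by
    rw [mul_pow, ← mul_assoc, ← pow_mul, ← pow_add, mul_comm (e / 4), Nat.mod_add_div]]
  have h1 := Low.X_pow_mul h (e / 4)
  generalize X ^ (e / 4) * φ = ψ at *
  rw [mem_low_iff] at *
  intro k hk
  have hs : e % 4 < 4 := Nat.mod_lt _ (by norm_num)
  generalize e % 4 = s at *
  rw [pow_four_eq_expand, coeff_X_pow_mul'] at hk
  split_ifs at hk with hsk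
  · rw [coeff_expand (by norm_num)] at hk
    split_ifs at hk with hdvd
    · have h2 := h1 _ hk
      obtain ⟨i, hi⟩ := hdvd
      obtain rfl : k = 4 * i + s := by omega
      rw [show (4 * i + s - s) / 4 = i by omega] at h2
      unfold height at *
      rw [codeA_four_mul_add i hs, codeB_four_mul_add i hs]
      push_cast at *
      omega
    · exact absurd rfl hk
  · exact absurd rfl hk

/-! ### Translation by a root of `u ^ 4 = X u + X ^ 2` or `u ^ 6 = X u + X ^ 2` -/

/-- The matrix of multiplication by `X + u` on `𝔽₂[X][u] / (u ^ 4 + X u + X ^ 2)`, in the basis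
`1, u, u ^ 2, u ^ 3`. -/
noncomputable def stepMatrix3 : Matrix (Fin 4) (Fin 4) (ZMod 2)[X] :=
  !![X, 0, 0, X ^ 2; 1, X, 0, X; 0, 1, X, 0; 0, 0, 1, X]

/-- The matrix of multiplication by `X + u` on `𝔽₂[X][u] / (u ^ 6 + X u + X ^ 2)`, in the basis
`1, u, …, u ^ 5`. -/
noncomputable def stepMatrix5 : Matrix (Fin 6) (Fin 6) (ZMod 2)[X] :=
  !![X, 0, 0, 0, 0, X ^ 2; 1, X, 0, 0, 0, X; 0, 1, X, 0, 0, 0; 0, 0, 1, X, 0, 0;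
    0, 0, 0, 1, X, 0; 0, 0, 0, 0, 1, X]

/-- The `i`-th coordinate of `φ(X + u)` in the basis `1, u, u ^ 2, u ^ 3` of
`𝔽₂[X][u] / (u ^ 4 + X u + X ^ 2)`. -/
noncomputable def coord3 (i : Fin 4) : (ZMod 2)[X] →ₗ[ZMod 2] (ZMod 2)[X] where
  toFun φ := aeval stepMatrix3 φ i 0
  map_add' := by simp
  map_smul' := by simp

/-- The `i`-th coordinate of `φ(X + u)` in the basis `1, u, …, u ^ 5` of
`𝔽₂[X][u] / (u ^ 6 + X u + X ^ 2)`. -/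
noncomputable def coord5 (i : Fin 6) : (ZMod 2)[X] →ₗ[ZMod 2] (ZMod 2)[X] where
  toFun φ := aeval stepMatrix5 φ i 0
  map_add' := by simp
  map_smul' := by simp

lemma coord3_one : coord3 0 1 = 1 ∧ coord3 1 1 = 0 ∧ coord3 2 1 = 0 ∧ coord3 3 1 = 0 := by
  simp [coord3]

lemma coord5_one : coord5 0 1 = 1 ∧ coord5 1 1 = 0 ∧ coord5 2 1 = 0 ∧ coord5 3 1 = 0 ∧
    coord5 4 1 = 0 ∧ coord5 5 1 = 0 := by
  simp [coord5]

lemma coord3_X_mul (φ : (ZMod 2)[X]) :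
    coord3 0 (X * φ) = X * coord3 0 φ + X ^ 2 * coord3 3 φ ∧
    coord3 1 (X * φ) = coord3 0 φ + X * coord3 1 φ + X * coord3 3 φ ∧
    coord3 2 (X * φ) = coord3 1 φ + X * coord3 2 φ ∧
    coord3 3 (X * φ) = coord3 2 φ + X * coord3 3 φ := by
  simp [coord3, Matrix.mul_apply, Fin.sum_univ_succ, stepMatrix3]
  ring

lemma coord5_X_mul (φ : (ZMod 2)[X]) :
    coord5 0 (X * φ) = X * coord5 0 φ + X ^ 2 * coord5 5 φ ∧
    coord5 1 (X * φ) = coord5 0 φ + X * coord5 1 φ + X * coord5 5 φ ∧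
    coord5 2 (X * φ) = coord5 1 φ + X * coord5 2 φ ∧
    coord5 3 (X * φ) = coord5 2 φ + X * coord5 3 φ ∧
    coord5 4 (X * φ) = coord5 3 φ + X * coord5 4 φ ∧
    coord5 5 (X * φ) = coord5 4 φ + X * coord5 5 φ := by
  simp [coord5, Matrix.mul_apply, Fin.sum_univ_succ, stepMatrix5]
  ring

/-- Induction for polynomials over `𝔽₂`. -/
lemma induction_X_mul {p : (ZMod 2)[X] → Prop} (zero : p 0) (one : p 1)
    (add : ∀ φ ψ, p φ → p ψ → p (φ + ψ)) (X_mul : ∀ φ, p φ → p (X * φ)) (φ : (ZMod 2)[X]) :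
    p φ := by
  have hpow : ∀ n : ℕ, p (X ^ n) := by
    intro n
    induction n with
    | zero => simpa using one
    | succ n ih => rw [pow_succ']; exact X_mul _ ih
  refine Polynomial.induction_on' φ add fun n a => ?_
  rcases (show a = 0 ∨ a = 1 by revert a; decide) with rfl | rfl
  · simpa using zero
  · rw [monomial_one_right_eq_X_pow]; exact hpow n

lemma coord3_sq (φ : (ZMod 2)[X]) :
    coord3 0 (φ ^ 2) = coord3 0 φ ^ 2 + X ^ 2 * coord3 2 φ ^ 2 ∧
    coord3 1 (φ ^ 2) = X * coord3 2 φ ^ 2 ∧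
    coord3 2 (φ ^ 2) = coord3 1 φ ^ 2 + X ^ 2 * coord3 3 φ ^ 2 ∧
    coord3 3 (φ ^ 2) = X * coord3 3 φ ^ 2 := by
  have h2 : (2 : (ZMod 2)[X]) = 0 := CharTwo.two_eq_zero
  induction φ using induction_X_mul with
  | zero => simp
  | one => simp [coord3_one]
  | add φ ψ hφ hψ => grind [CharTwo.add_sq]
  | X_mul φ ih =>
    obtain ⟨h0, h1, h2, h3⟩ := ih
    have e : (X * φ) ^ 2 = X * (X * φ ^ 2) := by ring
    obtain ⟨a0, a1, a2, a3⟩ := coord3_X_mul φ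
    obtain ⟨b0, b1, b2, b3⟩ := coord3_X_mul (φ ^ 2)
    obtain ⟨c0, c1, c2, c3⟩ := coord3_X_mul (X * φ ^ 2)
    rw [e, c0, c1, c2, c3, b0, b1, b2, b3, a0, a1, a2, a3, h0, h1, h2, h3]
    refine ⟨?_, ?_, ?_, ?_⟩ <;> grind

lemma coord5_sq (φ : (ZMod 2)[X]) :
    coord5 0 (φ ^ 2) = coord5 0 φ ^ 2 + X ^ 2 * coord5 3 φ ^ 2 ∧
    coord5 1 (φ ^ 2) = X * coord5 3 φ ^ 2 ∧
    coord5 2 (φ ^ 2) = coord5 1 φ ^ 2 + X ^ 2 * coord5 4 φ ^ 2 ∧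
    coord5 3 (φ ^ 2) = X * coord5 4 φ ^ 2 ∧
    coord5 4 (φ ^ 2) = coord5 2 φ ^ 2 + X ^ 2 * coord5 5 φ ^ 2 ∧
    coord5 5 (φ ^ 2) = X * coord5 5 φ ^ 2 := by
  have h2 : (2 : (ZMod 2)[X]) = 0 := CharTwo.two_eq_zero
  induction φ using induction_X_mul with
  | zero => simp
  | one => simp [coord5_one]
  | add φ ψ hφ hψ => grind [CharTwo.add_sq]
  | X_mul φ ih =>
    obtain ⟨h0, h1, h2, h3, h4, h5⟩ := ih
    have e : (X * φ) ^ 2 = X * (X * φ ^ 2) := by ring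
    obtain ⟨a0, a1, a2, a3, a4, a5⟩ := coord5_X_mul φ
    obtain ⟨b0, b1, b2, b3, b4, b5⟩ := coord5_X_mul (φ ^ 2)
    obtain ⟨c0, c1, c2, c3, c4, c5⟩ := coord5_X_mul (X * φ ^ 2)
    rw [e, c0, c1, c2, c3, c4, c5, b0, b1, b2, b3, b4, b5, a0, a1, a2, a3, a4, a5,
      h0, h1, h2, h3, h4, h5]
    refine ⟨?_, ?_, ?_, ?_, ?_, ?_⟩ <;> grind

/-! ### Coordinates of `X ^ s φ ^ 4` for `s < 4` -/

lemma coord3_pow_four (φ : (ZMod 2)[X]) :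
    coord3 0 (φ ^ 4) = X ^ 0 * coord3 0 φ ^ 4 + (X ^ 2 * coord3 1 φ ^ 4 +
      (X ^ 4 * coord3 2 φ ^ 4 + X ^ 6 * coord3 3 φ ^ 4)) ∧
    coord3 1 (φ ^ 4) = X ^ 1 * coord3 1 φ ^ 4 + X ^ 5 * coord3 3 φ ^ 4 ∧
    coord3 2 (φ ^ 4) = X ^ 2 * coord3 2 φ ^ 4 + X ^ 4 * coord3 3 φ ^ 4 ∧
    coord3 3 (φ ^ 4) = X ^ 3 * coord3 3 φ ^ 4 := by
  obtain ⟨h0, h1, h2, h3⟩ := coord3_sq φ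
  obtain ⟨k0, k1, k2, k3⟩ := coord3_sq (φ ^ 2)
  rw [show φ ^ 4 = (φ ^ 2) ^ 2 by ring, k0, k1, k2, k3, h0, h1, h2, h3]
  simp only [CharTwo.add_sq]
  refine ⟨?_, ?_, ?_, ?_⟩ <;> ring

lemma coord3_X_mul_pow_four (φ : (ZMod 2)[X]) :
    coord3 0 (X * φ ^ 4) = X ^ 1 * coord3 0 φ ^ 4 + (X ^ 3 * coord3 1 φ ^ 4 +
      (X ^ 5 * coord3 2 φ ^ 4 + (X ^ 5 * coord3 3 φ ^ 4 + X ^ 7 * coord3 3 φ ^ 4))) ∧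
    coord3 1 (X * φ ^ 4) = X ^ 0 * coord3 0 φ ^ 4 + (X ^ 4 * coord3 2 φ ^ 4 +
      X ^ 4 * coord3 3 φ ^ 4) ∧
    coord3 2 (X * φ ^ 4) = X ^ 1 * coord3 1 φ ^ 4 + X ^ 3 * coord3 2 φ ^ 4 ∧
    coord3 3 (X * φ ^ 4) = X ^ 2 * coord3 2 φ ^ 4 := by
  have h2 : (2 : (ZMod 2)[X]) = 0 := CharTwo.two_eq_zero
  obtain ⟨h0, h1, h2, h3⟩ := coord3_pow_four φ
  obtain ⟨k0, k1, k2, k3⟩ := coord3_X_mul (φ ^ 4)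
  rw [k0, k1, k2, k3, h0, h1, h2, h3]
  refine ⟨?_, ?_, ?_, ?_⟩ <;> grind

lemma coord3_X_sq_mul_pow_four (φ : (ZMod 2)[X]) :
    coord3 0 (X ^ 2 * φ ^ 4) = X ^ 2 * coord3 0 φ ^ 4 + (X ^ 4 * coord3 1 φ ^ 4 +
      (X ^ 4 * coord3 2 φ ^ 4 + (X ^ 6 * coord3 2 φ ^ 4 + (X ^ 6 * coord3 3 φ ^ 4 +
      X ^ 8 * coord3 3 φ ^ 4)))) ∧
    coord3 1 (X ^ 2 * φ ^ 4) = X ^ 3 * coord3 1 φ ^ 4 + (X ^ 3 * coord3 2 φ ^ 4 +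
      X ^ 7 * coord3 3 φ ^ 4) ∧
    coord3 2 (X ^ 2 * φ ^ 4) = X ^ 0 * coord3 0 φ ^ 4 + (X ^ 2 * coord3 1 φ ^ 4 +
      X ^ 4 * coord3 3 φ ^ 4) ∧
    coord3 3 (X ^ 2 * φ ^ 4) = X ^ 1 * coord3 1 φ ^ 4 := by
  have h2 : (2 : (ZMod 2)[X]) = 0 := CharTwo.two_eq_zero
  obtain ⟨h0, h1, h2, h3⟩ := coord3_X_mul_pow_four φ
  obtain ⟨k0, k1, k2, k3⟩ := coord3_X_mul (X * φ ^ 4)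
  rw [show X ^ 2 * φ ^ 4 = X * (X * φ ^ 4) by ring, k0, k1, k2, k3, h0, h1, h2, h3]
  refine ⟨?_, ?_, ?_, ?_⟩ <;> grind

lemma coord3_X_cube_mul_pow_four (φ : (ZMod 2)[X]) :
    coord3 0 (X ^ 3 * φ ^ 4) = X ^ 3 * coord3 0 φ ^ 4 + (X ^ 3 * coord3 1 φ ^ 4 +
      (X ^ 5 * coord3 1 φ ^ 4 + (X ^ 5 * coord3 2 φ ^ 4 + (X ^ 7 * coord3 2 φ ^ 4 +
      (X ^ 7 * coord3 3 φ ^ 4 + X ^ 9 * coord3 3 φ ^ 4))))) ∧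
    coord3 1 (X ^ 3 * φ ^ 4) = X ^ 2 * coord3 0 φ ^ 4 + (X ^ 2 * coord3 1 φ ^ 4 +
      (X ^ 6 * coord3 2 φ ^ 4 + X ^ 6 * coord3 3 φ ^ 4)) ∧
    coord3 2 (X ^ 3 * φ ^ 4) = X ^ 1 * coord3 0 φ ^ 4 + (X ^ 3 * coord3 2 φ ^ 4 +
      (X ^ 5 * coord3 3 φ ^ 4 + X ^ 7 * coord3 3 φ ^ 4)) ∧
    coord3 3 (X ^ 3 * φ ^ 4) = X ^ 0 * coord3 0 φ ^ 4 + X ^ 4 * coord3 3 φ ^ 4 := by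
  have h2 : (2 : (ZMod 2)[X]) = 0 := CharTwo.two_eq_zero
  obtain ⟨h0, h1, h2, h3⟩ := coord3_X_sq_mul_pow_four φ
  obtain ⟨k0, k1, k2, k3⟩ := coord3_X_mul (X ^ 2 * φ ^ 4)
  rw [show X ^ 3 * φ ^ 4 = X * (X ^ 2 * φ ^ 4) by ring, k0, k1, k2, k3, h0, h1, h2, h3]
  refine ⟨?_, ?_, ?_, ?_⟩ <;> grind

lemma coord5_pow_four (φ : (ZMod 2)[X]) :
    coord5 0 (φ ^ 4) = X ^ 0 * coord5 0 φ ^ 4 + (X ^ 4 * coord5 3 φ ^ 4 +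
      X ^ 4 * coord5 4 φ ^ 4) ∧
    coord5 1 (φ ^ 4) = X ^ 3 * coord5 4 φ ^ 4 ∧
    coord5 2 (φ ^ 4) = X ^ 2 * coord5 2 φ ^ 4 + (X ^ 2 * coord5 3 φ ^ 4 +
      X ^ 6 * coord5 5 φ ^ 4) ∧
    coord5 3 (φ ^ 4) = X ^ 1 * coord5 2 φ ^ 4 + X ^ 5 * coord5 5 φ ^ 4 ∧
    coord5 4 (φ ^ 4) = X ^ 0 * coord5 1 φ ^ 4 + (X ^ 4 * coord5 4 φ ^ 4 +
      X ^ 4 * coord5 5 φ ^ 4) ∧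
    coord5 5 (φ ^ 4) = X ^ 3 * coord5 5 φ ^ 4 := by
  obtain ⟨h0, h1, h2, h3, h4, h5⟩ := coord5_sq φ
  obtain ⟨k0, k1, k2, k3, k4, k5⟩ := coord5_sq (φ ^ 2)
  rw [show φ ^ 4 = (φ ^ 2) ^ 2 by ring, k0, k1, k2, k3, k4, k5, h0, h1, h2, h3, h4, h5]
  simp only [CharTwo.add_sq]
  refine ⟨?_, ?_, ?_, ?_, ?_, ?_⟩ <;> ring

lemma coord5_X_mul_pow_four (φ : (ZMod 2)[X]) :
    coord5 0 (X * φ ^ 4) = X ^ 1 * coord5 0 φ ^ 4 + (X ^ 5 * coord5 3 φ ^ 4 +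
      (X ^ 5 * coord5 4 φ ^ 4 + X ^ 5 * coord5 5 φ ^ 4)) ∧
    coord5 1 (X * φ ^ 4) = X ^ 0 * coord5 0 φ ^ 4 + (X ^ 4 * coord5 3 φ ^ 4 +
      X ^ 4 * coord5 5 φ ^ 4) ∧
    coord5 2 (X * φ ^ 4) = X ^ 3 * coord5 2 φ ^ 4 + (X ^ 3 * coord5 3 φ ^ 4 +
      (X ^ 3 * coord5 4 φ ^ 4 + X ^ 7 * coord5 5 φ ^ 4)) ∧
    coord5 3 (X * φ ^ 4) = X ^ 2 * coord5 3 φ ^ 4 ∧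
    coord5 4 (X * φ ^ 4) = X ^ 1 * coord5 1 φ ^ 4 + (X ^ 1 * coord5 2 φ ^ 4 +
      X ^ 5 * coord5 4 φ ^ 4) ∧
    coord5 5 (X * φ ^ 4) = X ^ 0 * coord5 1 φ ^ 4 + X ^ 4 * coord5 4 φ ^ 4 := by
  have h2 : (2 : (ZMod 2)[X]) = 0 := CharTwo.two_eq_zero
  obtain ⟨h0, h1, h2, h3, h4, h5⟩ := coord5_pow_four φ
  obtain ⟨k0, k1, k2, k3, k4, k5⟩ := coord5_X_mul (φ ^ 4)
  rw [k0, k1, k2, k3, k4, k5,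
    h0, h1, h2, h3, h4, h5]
  refine ⟨?_, ?_, ?_, ?_, ?_, ?_⟩ <;> grind

lemma coord5_X_sq_mul_pow_four (φ : (ZMod 2)[X]) :
    coord5 0 (X ^ 2 * φ ^ 4) = X ^ 2 * coord5 0 φ ^ 4 + (X ^ 2 * coord5 1 φ ^ 4 +
      (X ^ 6 * coord5 3 φ ^ 4 + X ^ 6 * coord5 5 φ ^ 4)) ∧
    coord5 1 (X ^ 2 * φ ^ 4) = X ^ 1 * coord5 1 φ ^ 4 ∧
    coord5 2 (X ^ 2 * φ ^ 4) = X ^ 0 * coord5 0 φ ^ 4 + (X ^ 4 * coord5 2 φ ^ 4 +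
      (X ^ 4 * coord5 4 φ ^ 4 + (X ^ 4 * coord5 5 φ ^ 4 + X ^ 8 * coord5 5 φ ^ 4))) ∧
    coord5 3 (X ^ 2 * φ ^ 4) = X ^ 3 * coord5 2 φ ^ 4 + (X ^ 3 * coord5 4 φ ^ 4 +
      X ^ 7 * coord5 5 φ ^ 4) ∧
    coord5 4 (X ^ 2 * φ ^ 4) = X ^ 2 * coord5 1 φ ^ 4 + (X ^ 2 * coord5 2 φ ^ 4 +
      (X ^ 2 * coord5 3 φ ^ 4 + X ^ 6 * coord5 4 φ ^ 4)) ∧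
    coord5 5 (X ^ 2 * φ ^ 4) = X ^ 1 * coord5 2 φ ^ 4 := by
  have h2 : (2 : (ZMod 2)[X]) = 0 := CharTwo.two_eq_zero
  obtain ⟨h0, h1, h2, h3, h4, h5⟩ := coord5_X_mul_pow_four φ
  obtain ⟨k0, k1, k2, k3, k4, k5⟩ := coord5_X_mul (X * φ ^ 4)
  rw [show X ^ 2 * φ ^ 4 = X * (X * φ ^ 4) by ring, k0, k1, k2, k3, k4, k5,
    h0, h1, h2, h3, h4, h5]
  refine ⟨?_, ?_, ?_, ?_, ?_, ?_⟩ <;> grind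

lemma coord5_X_cube_mul_pow_four (φ : (ZMod 2)[X]) :
    coord5 0 (X ^ 3 * φ ^ 4) = X ^ 3 * coord5 0 φ ^ 4 + (X ^ 3 * coord5 1 φ ^ 4 +
      (X ^ 3 * coord5 2 φ ^ 4 + (X ^ 7 * coord5 3 φ ^ 4 + X ^ 7 * coord5 5 φ ^ 4))) ∧
    coord5 1 (X ^ 3 * φ ^ 4) = X ^ 2 * coord5 0 φ ^ 4 + (X ^ 2 * coord5 2 φ ^ 4 +
      (X ^ 6 * coord5 3 φ ^ 4 + X ^ 6 * coord5 5 φ ^ 4)) ∧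
    coord5 2 (X ^ 3 * φ ^ 4) = X ^ 1 * coord5 0 φ ^ 4 + (X ^ 1 * coord5 1 φ ^ 4 +
      (X ^ 5 * coord5 2 φ ^ 4 + (X ^ 5 * coord5 4 φ ^ 4 + (X ^ 5 * coord5 5 φ ^ 4 +
      X ^ 9 * coord5 5 φ ^ 4)))) ∧
    coord5 3 (X ^ 3 * φ ^ 4) = X ^ 0 * coord5 0 φ ^ 4 + X ^ 4 * coord5 5 φ ^ 4 ∧
    coord5 4 (X ^ 3 * φ ^ 4) = X ^ 3 * coord5 1 φ ^ 4 + (X ^ 3 * coord5 3 φ ^ 4 +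
      (X ^ 3 * coord5 4 φ ^ 4 + (X ^ 7 * coord5 4 φ ^ 4 + X ^ 7 * coord5 5 φ ^ 4))) ∧
    coord5 5 (X ^ 3 * φ ^ 4) = X ^ 2 * coord5 1 φ ^ 4 + (X ^ 2 * coord5 3 φ ^ 4 +
      X ^ 6 * coord5 4 φ ^ 4) := by
  have h2 : (2 : (ZMod 2)[X]) = 0 := CharTwo.two_eq_zero
  obtain ⟨h0, h1, h2, h3, h4, h5⟩ := coord5_X_sq_mul_pow_four φ
  obtain ⟨k0, k1, k2, k3, k4, k5⟩ := coord5_X_mul (X ^ 2 * φ ^ 4)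
  rw [show X ^ 3 * φ ^ 4 = X * (X ^ 2 * φ ^ 4) by ring, k0, k1, k2, k3, k4, k5,
    h0, h1, h2, h3, h4, h5]
  refine ⟨?_, ?_, ?_, ?_, ?_, ?_⟩ <;> grind

/-! ### Leading monomials of the coordinates -/

/-- The behaviour of the coordinates of `(X + u) ^ j`, modulo `u ^ 4 + X u + X ^ 2`, with respect to
the lexicographic filtration. The shifts are chosen so that the formulas of
`coord3_pow_four` and `coord3_X_mul` reproduce them; only `c1` and `lead` matter in the end. -/
structure Dominated3 (j : ℕ) : Prop where
  c0 : coord3 0 (X ^ j) + X ^ j ∈ Low (height j) (codeB j - 1)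
  c1 : coord3 1 (X ^ j) ∈ Low (height j - 1) (codeB j)
  c2 : coord3 2 (X ^ j) ∈ Low (height j - 1) (codeB j - 1)
  c3 : coord3 3 (X ^ j) ∈ Low (height j - 2) (codeB j - 1)
  lead : codeA j ≠ 0 → ∃ i, codeA i + 1 = codeA j ∧ codeB i = codeB j ∧
    coord3 1 (X ^ j) + X ^ i ∈ Low (height j - 1) (codeB j - 1)

/-- The behaviour of the coordinates of `(X + u) ^ j`, modulo `u ^ 6 + X u + X ^ 2`, with respect to
the lexicographic filtration. The shifts are chosen so that the formulas of
`coord5_pow_four` and `coord5_X_mul` reproduce them; only `c2` and `lead` matter in the end. -/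
structure Dominated5 (j : ℕ) : Prop where
  c0 : coord5 0 (X ^ j) + X ^ j ∈ Low (height j) (codeB j - 1)
  c1 : coord5 1 (X ^ j) ∈ Low (height j - 1) (codeB j)
  c2 : coord5 2 (X ^ j) ∈ Low (height j - 1) (codeB j - 1)
  c3 : coord5 3 (X ^ j) ∈ Low (height j - 1) (codeB j - 2)
  c4 : coord5 4 (X ^ j) ∈ Low (height j - 2) (codeB j)
  c5 : coord5 5 (X ^ j) ∈ Low (height j - 2) (codeB j - 2)
  lead : codeB j ≠ 0 → ∃ i, codeA i = codeA j ∧ codeB i + 1 = codeB j ∧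
    coord5 2 (X ^ j) + X ^ i ∈ Low (height j - 1) (codeB j - 2)

lemma mem_low_of_add_mem {n d : ℤ} {φ ψ : (ZMod 2)[X]} (h : φ + ψ ∈ Low n d) (hψ : ψ ∈ Low n d) :
    φ ∈ Low n d := by
  simpa using sub_mem h hψ

/-- A leading term `X ^ e * φ ^ 4` is compared with a monomial by comparing `φ` with a monomial. -/
lemma mem_low_of_lead {N D : ℤ} {φ ψ ρ : (ZMod 2)[X]} {e i j : ℕ} (hi : i = 4 * j + e)
    (h : X ^ e * (φ + X ^ j) ^ 4 ∈ Low N D) (hρ : ρ ∈ Low N D) (hψ : ψ = X ^ e * φ ^ 4 + ρ) :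
    ψ + X ^ i ∈ Low N D := by
  have h4 : (φ + X ^ j) ^ 4 = φ ^ 4 + (X ^ j) ^ 4 := by
    rw [show (4 : ℕ) = 2 ^ 2 by rfl, add_pow_char_pow]
  have : ψ + X ^ i = X ^ e * (φ + X ^ j) ^ 4 + ρ := by
    rw [hψ, h4, hi]
    ring
  rw [this]
  exact add_mem h hρ

lemma dominated3 (j : ℕ) : Dominated3 j := by
  induction j using Nat.strong_induction_on with
  | _ j ih =>
    rcases Nat.eq_zero_or_pos j with rfl | hj
    · obtain ⟨h0, h1, h2, h3⟩ := coord3_one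
      have hd : (1 : (ZMod 2)[X]) + 1 = 0 := CharTwo.add_self_eq_zero 1
      constructor <;> simp [h0, h1, h2, h3, hd, codeA_zero]
    obtain ⟨k, s, hs, rfl⟩ : ∃ k s, s < 4 ∧ j = 4 * k + s := ⟨j / 4, j % 4, by omega, by omega⟩
    obtain ⟨g0, g1, g2, g3, gl⟩ := ih k (by omega)
    have hA := codeA_four_mul_add k hs
    have hB := codeB_four_mul_add k hs
    have hh : height k = codeA k + codeB k := rfl
    have hh' : height (4 * k + s) = codeA (4 * k + s) + codeB (4 * k + s) := rfl
    have g0' : coord3 0 (X ^ k) ∈ Low (height k) (codeB k) :=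
      mem_low_of_add_mem (Low.mono g0 (by omega)) (X_pow_mem_low k)
    have e : (X ^ (4 * k + s) : (ZMod 2)[X]) = X ^ s * (X ^ k) ^ 4 := by ring
    have hAi (i t : ℕ) (ht : t < 4) := codeA_four_mul_add i ht
    have hBi (i t : ℕ) (ht : t < 4) := codeB_four_mul_add i ht
    interval_cases s
    · rw [pow_zero, one_mul] at e
      obtain ⟨a0, a1, a2, a3⟩ := coord3_pow_four (X ^ k)
      rw [← e] at a0 a1 a2 a3
      generalize coord3 0 (X ^ k) = v0, coord3 1 (X ^ k) = v1, coord3 2 (X ^ k) = v2,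
        coord3 3 (X ^ k) = v3 at *
      refine ⟨mem_low_of_lead (e := 0) (j := k) rfl (Low.X_pow_mul_pow_four g0 _ (by omega)) ?_ a0,
        ?_, ?_, ?_, fun h => ?_⟩
      on_goal 2 => rw [a1]
      on_goal 3 => rw [a2]
      on_goal 4 => rw [a3]
      on_goal 5 =>
        obtain ⟨i, hi, hi', hl⟩ := gl (by omega)
        refine ⟨4 * i + 1, by have := hAi i 1; omega, by have := hBi i 1; omega,
          mem_low_of_lead (e := 1) (j := i) rfl (Low.X_pow_mul_pow_four hl _ (by omega)) ?_ a1⟩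
      all_goals
        repeat' with_reducible apply Low.add
      all_goals first
        | (with_reducible refine Low.X_pow_mul_pow_four g1 _ ?_); omega
        | (with_reducible refine Low.X_pow_mul_pow_four g2 _ ?_); omega
        | (with_reducible refine Low.X_pow_mul_pow_four g3 _ ?_); omega
    · rw [pow_one] at e
      obtain ⟨a0, a1, a2, a3⟩ := coord3_X_mul_pow_four (X ^ k)
      rw [← e] at a0 a1 a2 a3
      generalize coord3 0 (X ^ k) = v0, coord3 1 (X ^ k) = v1, coord3 2 (X ^ k) = v2,
        coord3 3 (X ^ k) = v3 at *
      refine ⟨mem_low_of_lead (e := 1) (j := k) rfl (Low.X_pow_mul_pow_four g0 _ (by omega)) ?_ a0,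
        ?_, ?_, ?_, fun h => ?_⟩
      on_goal 2 => rw [a1]
      on_goal 3 => rw [a2]
      on_goal 4 => rw [a3]
      on_goal 5 =>
        refine ⟨4 * k + 0, by have := hAi k 0; omega, by have := hBi k 0; omega,
          mem_low_of_lead (e := 0) (j := k) rfl (Low.X_pow_mul_pow_four g0 _ (by omega)) ?_ a1⟩
      all_goals
        repeat' with_reducible apply Low.add
      all_goals first
        | (with_reducible refine Low.X_pow_mul_pow_four g0' _ ?_); omega
        | (with_reducible refine Low.X_pow_mul_pow_four g1 _ ?_); omega
        | (with_reducible refine Low.X_pow_mul_pow_four g2 _ ?_); omega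
        | (with_reducible refine Low.X_pow_mul_pow_four g3 _ ?_); omega
    · obtain ⟨a0, a1, a2, a3⟩ := coord3_X_sq_mul_pow_four (X ^ k)
      rw [← e] at a0 a1 a2 a3
      generalize coord3 0 (X ^ k) = v0, coord3 1 (X ^ k) = v1, coord3 2 (X ^ k) = v2,
        coord3 3 (X ^ k) = v3 at *
      refine ⟨mem_low_of_lead (e := 2) (j := k) rfl (Low.X_pow_mul_pow_four g0 _ (by omega)) ?_ a0,
        ?_, ?_, ?_, fun h => ?_⟩
      on_goal 2 => rw [a1]
      on_goal 3 => rw [a2]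
      on_goal 4 => rw [a3]
      on_goal 5 =>
        obtain ⟨i, hi, hi', hl⟩ := gl (by omega)
        refine ⟨4 * i + 3, by have := hAi i 3; omega, by have := hBi i 3; omega,
          mem_low_of_lead (e := 3) (j := i) rfl (Low.X_pow_mul_pow_four hl _ (by omega)) ?_ a1⟩
      all_goals
        repeat' with_reducible apply Low.add
      all_goals first
        | (with_reducible refine Low.X_pow_mul_pow_four g0' _ ?_); omega
        | (with_reducible refine Low.X_pow_mul_pow_four g1 _ ?_); omega
        | (with_reducible refine Low.X_pow_mul_pow_four g2 _ ?_); omega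
        | (with_reducible refine Low.X_pow_mul_pow_four g3 _ ?_); omega
    · obtain ⟨a0, a1, a2, a3⟩ := coord3_X_cube_mul_pow_four (X ^ k)
      rw [← e] at a0 a1 a2 a3
      generalize coord3 0 (X ^ k) = v0, coord3 1 (X ^ k) = v1, coord3 2 (X ^ k) = v2,
        coord3 3 (X ^ k) = v3 at *
      refine ⟨mem_low_of_lead (e := 3) (j := k) rfl (Low.X_pow_mul_pow_four g0 _ (by omega)) ?_ a0,
        ?_, ?_, ?_, fun h => ?_⟩
      on_goal 2 => rw [a1]
      on_goal 3 => rw [a2]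
      on_goal 4 => rw [a3]
      on_goal 5 =>
        refine ⟨4 * k + 2, by have := hAi k 2; omega, by have := hBi k 2; omega,
          mem_low_of_lead (e := 2) (j := k) rfl (Low.X_pow_mul_pow_four g0 _ (by omega)) ?_ a1⟩
      all_goals
        repeat' with_reducible apply Low.add
      all_goals first
        | (with_reducible refine Low.X_pow_mul_pow_four g0' _ ?_); omega
        | (with_reducible refine Low.X_pow_mul_pow_four g1 _ ?_); omega
        | (with_reducible refine Low.X_pow_mul_pow_four g2 _ ?_); omega
        | (with_reducible refine Low.X_pow_mul_pow_four g3 _ ?_); omega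

lemma dominated5 (j : ℕ) : Dominated5 j := by
  induction j using Nat.strong_induction_on with
  | _ j ih =>
    rcases Nat.eq_zero_or_pos j with rfl | hj
    · obtain ⟨h0, h1, h2, h3, h4, h5⟩ := coord5_one
      have hd : (1 : (ZMod 2)[X]) + 1 = 0 := CharTwo.add_self_eq_zero 1
      constructor <;> simp [h0, h1, h2, h3, h4, h5, hd, codeB_zero]
    obtain ⟨k, s, hs, rfl⟩ : ∃ k s, s < 4 ∧ j = 4 * k + s := ⟨j / 4, j % 4, by omega, by omega⟩
    obtain ⟨g0, g1, g2, g3, g4, g5, gl⟩ := ih k (by omega)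
    have hA := codeA_four_mul_add k hs
    have hB := codeB_four_mul_add k hs
    have hh : height k = codeA k + codeB k := rfl
    have hh' : height (4 * k + s) = codeA (4 * k + s) + codeB (4 * k + s) := rfl
    have g0' : coord5 0 (X ^ k) ∈ Low (height k) (codeB k) :=
      mem_low_of_add_mem (Low.mono g0 (by omega)) (X_pow_mem_low k)
    have e : (X ^ (4 * k + s) : (ZMod 2)[X]) = X ^ s * (X ^ k) ^ 4 := by ring
    have hAi (i t : ℕ) (ht : t < 4) := codeA_four_mul_add i ht
    have hBi (i t : ℕ) (ht : t < 4) := codeB_four_mul_add i ht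
    interval_cases s
    · rw [pow_zero, one_mul] at e
      obtain ⟨a0, a1, a2, a3, a4, a5⟩ := coord5_pow_four (X ^ k)
      rw [← e] at a0 a1 a2 a3 a4 a5
      generalize coord5 0 (X ^ k) = v0, coord5 1 (X ^ k) = v1, coord5 2 (X ^ k) = v2,
        coord5 3 (X ^ k) = v3, coord5 4 (X ^ k) = v4, coord5 5 (X ^ k) = v5 at *
      refine ⟨mem_low_of_lead (e := 0) (j := k) rfl (Low.X_pow_mul_pow_four g0 _ (by omega)) ?_ a0,
        ?_, ?_, ?_, ?_, ?_, fun h => ?_⟩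
      on_goal 2 => rw [a1]
      on_goal 3 => rw [a2]
      on_goal 4 => rw [a3]
      on_goal 5 => rw [a4]
      on_goal 6 => rw [a5]
      on_goal 7 =>
        obtain ⟨i, hi, hi', hl⟩ := gl (by omega)
        refine ⟨4 * i + 2, by have := hAi i 2; omega, by have := hBi i 2; omega,
          mem_low_of_lead (e := 2) (j := i) rfl (Low.X_pow_mul_pow_four hl _ (by omega)) ?_ a2⟩
      all_goals
        repeat' with_reducible apply Low.add
      all_goals first
        | (with_reducible refine Low.X_pow_mul_pow_four g1 _ ?_); omega
        | (with_reducible refine Low.X_pow_mul_pow_four g2 _ ?_); omega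
        | (with_reducible refine Low.X_pow_mul_pow_four g3 _ ?_); omega
        | (with_reducible refine Low.X_pow_mul_pow_four g4 _ ?_); omega
        | (with_reducible refine Low.X_pow_mul_pow_four g5 _ ?_); omega
    · rw [pow_one] at e
      obtain ⟨a0, a1, a2, a3, a4, a5⟩ := coord5_X_mul_pow_four (X ^ k)
      rw [← e] at a0 a1 a2 a3 a4 a5
      generalize coord5 0 (X ^ k) = v0, coord5 1 (X ^ k) = v1, coord5 2 (X ^ k) = v2,
        coord5 3 (X ^ k) = v3, coord5 4 (X ^ k) = v4, coord5 5 (X ^ k) = v5 at *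
      refine ⟨mem_low_of_lead (e := 1) (j := k) rfl (Low.X_pow_mul_pow_four g0 _ (by omega)) ?_ a0,
        ?_, ?_, ?_, ?_, ?_, fun h => ?_⟩
      on_goal 2 => rw [a1]
      on_goal 3 => rw [a2]
      on_goal 4 => rw [a3]
      on_goal 5 => rw [a4]
      on_goal 6 => rw [a5]
      on_goal 7 =>
        obtain ⟨i, hi, hi', hl⟩ := gl (by omega)
        refine ⟨4 * i + 3, by have := hAi i 3; omega, by have := hBi i 3; omega,
          mem_low_of_lead (e := 3) (j := i) rfl (Low.X_pow_mul_pow_four hl _ (by omega)) ?_ a2⟩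
      all_goals
        repeat' with_reducible apply Low.add
      all_goals first
        | (with_reducible refine Low.X_pow_mul_pow_four g0' _ ?_); omega
        | (with_reducible refine Low.X_pow_mul_pow_four g1 _ ?_); omega
        | (with_reducible refine Low.X_pow_mul_pow_four g2 _ ?_); omega
        | (with_reducible refine Low.X_pow_mul_pow_four g3 _ ?_); omega
        | (with_reducible refine Low.X_pow_mul_pow_four g4 _ ?_); omega
        | (with_reducible refine Low.X_pow_mul_pow_four g5 _ ?_); omega
    · obtain ⟨a0, a1, a2, a3, a4, a5⟩ := coord5_X_sq_mul_pow_four (X ^ k)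
      rw [← e] at a0 a1 a2 a3 a4 a5
      generalize coord5 0 (X ^ k) = v0, coord5 1 (X ^ k) = v1, coord5 2 (X ^ k) = v2,
        coord5 3 (X ^ k) = v3, coord5 4 (X ^ k) = v4, coord5 5 (X ^ k) = v5 at *
      refine ⟨mem_low_of_lead (e := 2) (j := k) rfl (Low.X_pow_mul_pow_four g0 _ (by omega)) ?_ a0,
        ?_, ?_, ?_, ?_, ?_, fun h => ?_⟩
      on_goal 2 => rw [a1]
      on_goal 3 => rw [a2]
      on_goal 4 => rw [a3]
      on_goal 5 => rw [a4]
      on_goal 6 => rw [a5]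
      on_goal 7 =>
        refine ⟨4 * k + 0, by have := hAi k 0; omega, by have := hBi k 0; omega,
          mem_low_of_lead (e := 0) (j := k) rfl (Low.X_pow_mul_pow_four g0 _ (by omega)) ?_ a2⟩
      all_goals
        repeat' with_reducible apply Low.add
      all_goals first
        | (with_reducible refine Low.X_pow_mul_pow_four g0' _ ?_); omega
        | (with_reducible refine Low.X_pow_mul_pow_four g1 _ ?_); omega
        | (with_reducible refine Low.X_pow_mul_pow_four g2 _ ?_); omega
        | (with_reducible refine Low.X_pow_mul_pow_four g3 _ ?_); omega
        | (with_reducible refine Low.X_pow_mul_pow_four g4 _ ?_); omega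
        | (with_reducible refine Low.X_pow_mul_pow_four g5 _ ?_); omega
    · obtain ⟨a0, a1, a2, a3, a4, a5⟩ := coord5_X_cube_mul_pow_four (X ^ k)
      rw [← e] at a0 a1 a2 a3 a4 a5
      generalize coord5 0 (X ^ k) = v0, coord5 1 (X ^ k) = v1, coord5 2 (X ^ k) = v2,
        coord5 3 (X ^ k) = v3, coord5 4 (X ^ k) = v4, coord5 5 (X ^ k) = v5 at *
      refine ⟨mem_low_of_lead (e := 3) (j := k) rfl (Low.X_pow_mul_pow_four g0 _ (by omega)) ?_ a0,
        ?_, ?_, ?_, ?_, ?_, fun h => ?_⟩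
      on_goal 2 => rw [a1]
      on_goal 3 => rw [a2]
      on_goal 4 => rw [a3]
      on_goal 5 => rw [a4]
      on_goal 6 => rw [a5]
      on_goal 7 =>
        refine ⟨4 * k + 1, by have := hAi k 1; omega, by have := hBi k 1; omega,
          mem_low_of_lead (e := 1) (j := k) rfl (Low.X_pow_mul_pow_four g0 _ (by omega)) ?_ a2⟩
      all_goals
        repeat' with_reducible apply Low.add
      all_goals first
        | (with_reducible refine Low.X_pow_mul_pow_four g0' _ ?_); omega
        | (with_reducible refine Low.X_pow_mul_pow_four g1 _ ?_); omega
        | (with_reducible refine Low.X_pow_mul_pow_four g2 _ ?_); omega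
        | (with_reducible refine Low.X_pow_mul_pow_four g3 _ ?_); omega
        | (with_reducible refine Low.X_pow_mul_pow_four g4 _ ?_); omega
        | (with_reducible refine Low.X_pow_mul_pow_four g5 _ ?_); omega

/-! ### The height of a polynomial -/

/-- All exponents of `φ` have height less than `n`. -/
def HeightLT (n : ℕ) (φ : (ZMod 2)[X]) : Prop :=
  ∀ j, φ.coeff j ≠ 0 → height j < n

lemma HeightLT.eq_zero {φ : (ZMod 2)[X]} (h : HeightLT 0 φ) : φ = 0 := by
  ext j
  by_contra hj
  exact absurd (h j (by simpa using hj)) (by omega)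

lemma map_mem_of_forall_X_pow {S : Submodule (ZMod 2) (ZMod 2)[X]}
    (L : (ZMod 2)[X] →ₗ[ZMod 2] (ZMod 2)[X]) (φ : (ZMod 2)[X])
    (h : ∀ j, φ.coeff j ≠ 0 → L (X ^ j) ∈ S) : L φ ∈ S := by
  rw [φ.as_sum_support_C_mul_X_pow, map_sum]
  refine sum_mem fun j hj => ?_
  rw [← smul_eq_C_mul, map_smul]
  exact S.smul_mem _ (h j (mem_support_iff.mp hj))

lemma coord3_mem_low {n d : ℤ} {φ : (ZMod 2)[X]} (h : φ ∈ Low n d) :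
    coord3 1 φ ∈ Low (n - 1) d := by
  rw [mem_low_iff] at h
  refine map_mem_of_forall_X_pow _ _ fun j hj => ?_
  have := h j hj
  exact Low.mono (dominated3 j).c1 (by omega)

lemma coord5_mem_low {n d : ℤ} {φ : (ZMod 2)[X]} (h : φ ∈ Low n d) :
    coord5 2 φ ∈ Low (n - 1) (d - 1) := by
  rw [mem_low_iff] at h
  refine map_mem_of_forall_X_pow _ _ fun j hj => ?_
  have := h j hj
  exact Low.mono (dominated5 j).c2 (by omega)

/-- A polynomial of height at most `n` lies in a step of the filtration with first index `n`. -/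
lemma HeightLT.mem_low {n : ℕ} {φ : (ZMod 2)[X]} (h : HeightLT (n + 1) φ) :
    φ ∈ Low (n : ℤ) n := by
  rw [mem_low_iff]
  intro j hj
  have h1 := h j hj
  have h2 : height j = codeA j + codeB j := rfl
  omega

lemma HeightLT.map_coord3 {n : ℕ} {φ : (ZMod 2)[X]} (h : HeightLT (n + 1) φ) :
    HeightLT n (coord3 1 φ) := by
  have := coord3_mem_low h.mem_low
  rw [mem_low_iff] at this
  intro j hj
  have := this j hj
  omega

lemma HeightLT.map_coord5 {n : ℕ} {φ : (ZMod 2)[X]} (h : HeightLT (n + 1) φ) :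
    HeightLT n (coord5 2 φ) := by
  have := coord5_mem_low h.mem_low
  rw [mem_low_iff] at this
  intro j hj
  have := this j hj
  omega

/-- If `ψ + X ^ i` lies in a step of the filtration that does not contain `X ^ i`, then `X ^ i`
occurs in `ψ`. -/
lemma coeff_ne_zero_of_add_mem_low {n d : ℤ} {ψ : (ZMod 2)[X]} {i : ℕ}
    (h : ψ + X ^ i ∈ Low n d) (hi : (height i : ℤ) = n) (hd : d < codeB i) :
    ψ.coeff i ≠ 0 := by
  rw [mem_low_iff] at h
  intro h0
  have := h i (by rw [coeff_add, h0, coeff_X_pow_self]; simp)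
  omega

/-- One of the two coordinates attached to `T₃` and `T₅` lowers the height of a non-constant
polynomial by exactly one. The leading monomial of `φ`, for the lexicographic order on codes,
survives in `coord5 2 φ` if its `codeB` is positive, and in `coord3 1 φ` otherwise. -/
lemma exists_height_coord {n : ℕ} {φ : (ZMod 2)[X]} (h : HeightLT (n + 2) φ)
    {j : ℕ} (hj : φ.coeff j ≠ 0) (hjn : height j = n + 1) :
    (∃ i, height i = n ∧ (coord3 1 φ).coeff i ≠ 0) ∨
      ∃ i, height i = n ∧ (coord5 2 φ).coeff i ≠ 0 := by
  obtain ⟨k, hk, hmax⟩ := Finset.exists_max_image (φ.support.filter fun j => height j = n + 1)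
    codeB ⟨j, by simp [hj, hjn]⟩
  simp only [Finset.mem_filter, mem_support_iff] at hk hmax
  obtain ⟨hk0, hkn⟩ := hk
  have hkn' : height k = codeA k + codeB k := rfl
  have hrest : φ + X ^ k ∈ Low ((n : ℤ) + 1) ((codeB k : ℤ) - 1) := by
    rw [mem_low_iff]
    intro i hi
    rcases eq_or_ne i k with rfl | hik
    · rw [coeff_add, coeff_X_pow_self] at hi
      have : ∀ a : ZMod 2, a ≠ 0 → a + 1 = 0 := by decide
      exact absurd (this _ hk0) hi
    · rw [coeff_add, coeff_X_pow, if_neg hik, add_zero] at hi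
      have h1 := h i hi
      have h2 : height i = codeA i + codeB i := rfl
      by_cases h3 : height i = n + 1
      · have h4 := hmax i ⟨hi, h3⟩
        have h5 : codeB i ≠ codeB k := fun h5 => hik (eq_of_code_eq (by omega) h5)
        omega
      · omega
  have hφ : φ = (φ + X ^ k) + X ^ k := by
    rw [add_assoc, CharTwo.add_self_eq_zero, add_zero]
  by_cases hB : codeB k = 0
  · left
    obtain ⟨i, hiA, hiB, hl⟩ := (dominated3 k).lead (by omega)
    have h6 : height i = codeA i + codeB i := rfl
    refine ⟨i, by omega, coeff_ne_zero_of_add_mem_low (n := n) (d := (codeB k : ℤ) - 1) ?_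
      (by omega) (by omega)⟩
    rw [hφ, map_add, add_assoc]
    exact Low.add (Low.mono (coord3_mem_low hrest) (by omega)) (Low.mono hl (by omega))
  · right
    obtain ⟨i, hiA, hiB, hl⟩ := (dominated5 k).lead hB
    have h6 : height i = codeA i + codeB i := rfl
    refine ⟨i, by omega, coeff_ne_zero_of_add_mem_low (n := n) (d := (codeB k : ℤ) - 2) ?_
      (by omega) (by omega)⟩
    rw [hφ, map_add, add_assoc]
    exact Low.add (Low.mono (coord5_mem_low hrest) (by omega)) (Low.mono hl (by omega))

/-- An operator that kills `1` and commutes with the operators attached to `T₃` and `T₅` lowers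
heights: by induction, both of these lower the height of `T φ` to at least two below that of `φ`,
which `exists_height_coord` allows only if `T φ` already has smaller height than `φ`. -/
lemma HeightLT.map_of_commute {T : (ZMod 2)[X] → (ZMod 2)[X]} (T_zero : T 0 = 0) (T_one : T 1 = 0)
    (comm3 : ∀ φ, coord3 1 (T φ) = T (coord3 1 φ)) (comm5 : ∀ φ, coord5 2 (T φ) = T (coord5 2 φ))
    (n : ℕ) : ∀ φ, HeightLT (n + 1) φ → HeightLT n (T φ) := by
  induction n with
  | zero =>
    intro φ hφ
    have hφ' : φ = C (φ.coeff 0) := by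
      ext j
      rw [coeff_C]
      split_ifs with h
      · rw [h]
      · by_contra hj
        exact h (eq_zero_of_height_eq_zero (by have := hφ j hj; omega))
    rcases (show φ.coeff 0 = 0 ∨ φ.coeff 0 = 1 by generalize φ.coeff 0 = a; revert a; decide)
      with h | h
    · rw [hφ', h, C_0, T_zero]
      intro j hj
      simp at hj
    · rw [hφ', h, C_1, T_one]
      intro j hj
      simp at hj
  | succ n ih =>
    intro φ hφ
    have h3 : HeightLT n (coord3 1 (T φ)) := comm3 φ ▸ ih _ hφ.map_coord3
    have h5 : HeightLT n (coord5 2 (T φ)) := comm5 φ ▸ ih _ hφ.map_coord5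
    by_contra hcon
    -- the largest height occurring in `T φ`
    have hne : ((T φ).support.filter fun j => n + 1 ≤ height j).Nonempty := by
      unfold HeightLT at hcon
      push Not at hcon
      obtain ⟨j, hj, hjn⟩ := hcon
      exact ⟨j, by simpa [hj] using hjn⟩
    obtain ⟨k, hk, hmax⟩ := Finset.exists_max_image _ height hne
    simp only [Finset.mem_filter, mem_support_iff] at hk hmax
    obtain ⟨m, hm⟩ : ∃ m, height k = m + 1 := ⟨height k - 1, by omega⟩
    have hle : HeightLT (m + 2) (T φ) := by
      intro j hj
      by_cases hjn : n + 1 ≤ height j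
      · have := hmax j ⟨hj, hjn⟩
        omega
      · omega
    rcases exists_height_coord hle hk.1 hm with ⟨i, hi, hi0⟩ | ⟨i, hi, hi0⟩
    · have := h3 i hi0
      omega
    · have := h5 i hi0
      omega

/-! ### Hecke operators on power series -/

/-- The `q`-expansion `∑ c(p n + i) q ^ n` extracted from `∑ c(n) q ^ n`. For `i = 0` this is the
operator `U_p`. -/
noncomputable def sect (p i : ℕ) : PowerSeries (ZMod 2) →ₗ[ZMod 2] PowerSeries (ZMod 2) where
  toFun f := PowerSeries.mk fun n => PowerSeries.coeff (p * n + i) f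
  map_add' f g := by ext; simp
  map_smul' c f := by ext; simp

lemma coeff_sect (p i n : ℕ) (f : PowerSeries (ZMod 2)) :
    PowerSeries.coeff n (sect p i f) = PowerSeries.coeff (p * n + i) f := by
  simp [sect]

lemma heckeT_eq {p : ℕ} (hp : p ≠ 0) (f : PowerSeries (ZMod 2)) :
    heckeT p f = sect p 0 f + PowerSeries.expand p hp f := by
  ext n
  rw [map_add, coeff_sect, PowerSeries.coeff_expand, heckeT, PowerSeries.coeff_mk]
  split_ifs <;> simp

lemma sect_expand_mul {p : ℕ} (hp : p ≠ 0) (f g : PowerSeries (ZMod 2)) :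
    sect p 0 (PowerSeries.expand p hp g * f) = g * sect p 0 f := by
  ext n
  rw [coeff_sect, PowerSeries.coeff_mul, PowerSeries.coeff_mul, add_zero]
  symm
  refine Finset.sum_of_injOn (fun x => (p * x.1, p * x.2)) ?_ ?_ ?_ ?_
  · rintro ⟨a, b⟩ - ⟨c, d⟩ - h
    simp only [Prod.mk.injEq] at h
    simpa [hp] using h
  · rintro ⟨a, b⟩ h
    simp only [Finset.mem_coe, Finset.HasAntidiagonal.mem_antidiagonal] at h ⊢
    rw [← mul_add, h]
  · rintro ⟨a, b⟩ h h'
    simp only [Finset.HasAntidiagonal.mem_antidiagonal] at h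
    rw [PowerSeries.coeff_expand_of_not_dvd, zero_mul]
    rintro ⟨a, rfl⟩
    have hb : p ∣ b := (Nat.dvd_add_right (dvd_mul_right p a)).mp (h ▸ dvd_mul_right p n)
    obtain ⟨b, rfl⟩ := hb
    refine h' ⟨(a, b), ?_, rfl⟩
    rw [← mul_add] at h
    simpa using Nat.eq_of_mul_eq_mul_left (Nat.pos_of_ne_zero hp) h
  · rintro ⟨a, b⟩ -
    rw [PowerSeries.coeff_expand_mul, coeff_sect, add_zero]

lemma eq_sum_expand_sect {p : ℕ} (hp : p ≠ 0) (f : PowerSeries (ZMod 2)) :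
    f = ∑ i : Fin p, PowerSeries.expand p hp (sect p i f) * PowerSeries.X ^ (i : ℕ) := by
  ext n
  have hp' : 0 < p := Nat.pos_of_ne_zero hp
  rw [map_sum, Finset.sum_eq_single (⟨n % p, Nat.mod_lt _ hp'⟩ : Fin p)]
  · rw [PowerSeries.coeff_mul_X_pow', if_pos (Nat.mod_le _ _)]
    have : n - n % p = p * (n / p) := by have := Nat.mod_add_div n p; omega
    simp only [this]
    rw [PowerSeries.coeff_expand_mul, coeff_sect]
    simp only [Nat.div_add_mod]
  · rintro i - hi
    rw [PowerSeries.coeff_mul_X_pow']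
    split_ifs with h
    · refine PowerSeries.coeff_expand_of_not_dvd _ _ _ ?_
      rintro ⟨k, hk⟩
      apply hi
      ext
      have : n = i + p * k := by omega
      simp [this, Nat.mod_eq_of_lt i.2]
    · rfl
  · simp

lemma sq_eq_expand (f : PowerSeries (ZMod 2)) :
    f ^ 2 = PowerSeries.expand 2 two_ne_zero f := by
  have h := MvPowerSeries.map_frobenius_expand 2 two_ne_zero (f := f)
  rw [ZMod.frobenius_zmod, MvPowerSeries.map_id] at h
  exact h.symm

lemma heckeT_add (p : ℕ) (f g : PowerSeries (ZMod 2)) :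
    heckeT p (f + g) = heckeT p f + heckeT p g := by
  ext n
  simp only [heckeT, PowerSeries.coeff_mk, map_add]
  split_ifs <;> ring

lemma heckeT_zero (p : ℕ) : heckeT p 0 = 0 := by
  ext n
  simp [heckeT]

lemma heckeT_sq {p : ℕ} (hp : p.Prime) (hodd : Odd p) (f : PowerSeries (ZMod 2)) :
    heckeT p (f ^ 2) = heckeT p f ^ 2 := by
  ext n
  have h2 : ∀ m, 2 ∣ p * m ↔ 2 ∣ m := fun m =>
    (Nat.Coprime.dvd_mul_left (Nat.coprime_two_left.mpr hodd))
  rw [sq_eq_expand, sq_eq_expand, PowerSeries.coeff_expand, heckeT, heckeT, PowerSeries.coeff_mk]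
  simp only [PowerSeries.coeff_expand, PowerSeries.coeff_mk, h2]
  have hp0 := hp.pos
  by_cases hn : 2 ∣ n
  · obtain ⟨k, rfl⟩ := hn
    have hdvd : p ∣ 2 * k ↔ p ∣ k := Nat.Coprime.dvd_mul_left (Nat.coprime_two_right.mpr hodd)
    have e1 : p * (2 * k) / 2 = p * k := by
      rw [show p * (2 * k) = 2 * (p * k) by ring, Nat.mul_div_cancel_left _ two_pos]
    simp only [e1, Nat.mul_div_cancel_left k two_pos, hdvd]
    by_cases hk : p ∣ k
    · obtain ⟨m, rfl⟩ := hk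
      have e2 : 2 * (p * m) / p = 2 * m := by
        rw [show 2 * (p * m) = p * (2 * m) by ring, Nat.mul_div_cancel_left _ hp0]
      simp [e2, Nat.mul_div_cancel_left m hp0]
    · simp [hk]
  · simp only [hn, if_false]
    split_ifs with h1 h2
    · exact absurd (h2.trans (Nat.div_dvd_of_dvd h1)) hn
    · simp
    · rfl

lemma heckeT_comm {p r : ℕ} (hp : p.Prime) (hr : r.Prime) (f : PowerSeries (ZMod 2)) :
    heckeT p (heckeT r f) = heckeT r (heckeT p f) := by
  rcases eq_or_ne p r with rfl | hpr
  · rfl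
  have hcop : Nat.Coprime p r := (Nat.coprime_primes hp hr).mpr hpr
  have hp0 := hp.pos
  have hr0 := hr.pos
  ext n
  simp only [heckeT, PowerSeries.coeff_mk]
  have e1 : r ∣ p * n ↔ r ∣ n := hcop.symm.dvd_mul_left
  have e2 : p ∣ r * n ↔ p ∣ n := hcop.dvd_mul_left
  have e0 : r * (p * n) = p * (r * n) := by ring
  simp only [e0, e1, e2]
  by_cases h1 : p ∣ n
  · obtain ⟨a, rfl⟩ := h1
    have e3 : r ∣ p * a ↔ r ∣ a := hcop.symm.dvd_mul_left
    have e4 : r * (p * a) / p = r * a := by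
      rw [show r * (p * a) = p * (r * a) by ring, Nat.mul_div_cancel_left _ hp0]
    simp only [Nat.mul_div_cancel_left _ hp0, e3, e4]
    by_cases h2 : r ∣ a
    · obtain ⟨b, rfl⟩ := h2
      have e5 : p * (p * (r * b)) / r = p * (p * b) := by
        rw [show p * (p * (r * b)) = r * (p * (p * b)) by ring, Nat.mul_div_cancel_left _ hr0]
      have e6 : p * (r * b) / r = p * b := by
        rw [show p * (r * b) = r * (p * b) by ring, Nat.mul_div_cancel_left _ hr0]
      simp only [dvd_mul_right, if_true, e5, e6, Nat.mul_div_cancel_left _ hr0,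
        Nat.mul_div_cancel_left _ hp0]
      ring
    · simp [h2]
  · by_cases h2 : r ∣ n
    · obtain ⟨b, rfl⟩ := h2
      have e3 : p ∣ b ↔ p ∣ r * b := hcop.dvd_mul_left.symm
      have e5 : p * (r * b) / r = p * b := by
        rw [show p * (r * b) = r * (p * b) by ring, Nat.mul_div_cancel_left _ hr0]
      simp [h1, e3, e5, Nat.mul_div_cancel_left _ hr0]
    · simp [h1, h2]

lemma heckeT_one {p : ℕ} (hp : p.Prime) : heckeT p 1 = 0 := by
  ext n
  have hp0 := hp.pos
  simp only [heckeT, PowerSeries.coeff_mk, PowerSeries.coeff_one, map_zero]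
  rcases Nat.eq_zero_or_pos n with rfl | hn
  · simpa using CharTwo.add_self_eq_zero (1 : ZMod 2)
  · have h1 : p * n ≠ 0 := by positivity
    by_cases hd : p ∣ n
    · have h2 : n / p ≠ 0 := (Nat.div_pos (Nat.le_of_dvd hn hd) hp0).ne'
      simp [h1, h2, hd]
    · simp [h1, hd]

lemma coeff_Delta (n : ℕ) [Decidable (∃ m : ℕ, n = (2 * m + 1) ^ 2)] :
    PowerSeries.coeff n DeltaMod2 = if ∃ m : ℕ, n = (2 * m + 1) ^ 2 then 1 else 0 := by
  rw [DeltaMod2, PowerSeries.coeff_mk]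
  split_ifs <;> rfl

lemma heckeT_Delta {p : ℕ} (hp : p.Prime) (hodd : Odd p) : heckeT p DeltaMod2 = 0 := by
  classical
  ext n
  have hp0 := hp.pos
  simp only [heckeT, PowerSeries.coeff_mk, coeff_Delta, map_zero]
  -- an odd square divisible by `p` is `p ^ 2` times an odd square
  have key : (∃ m : ℕ, p * n = (2 * m + 1) ^ 2) → ∃ k, n = p * (2 * k + 1) ^ 2 := by
    rintro ⟨m, hm⟩
    obtain ⟨c, hc⟩ := hp.dvd_of_dvd_pow (Dvd.intro _ hm)
    have hcodd : Odd c := by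
      have : Odd (p * c) := hc ▸ odd_two_mul_add_one m
      exact (Nat.odd_mul.mp this).2
    obtain ⟨k, rfl⟩ := hcodd
    refine ⟨k, Nat.eq_of_mul_eq_mul_left hp0 ?_⟩
    rw [hm, hc]
    ring
  by_cases h : ∃ k, n = p * (2 * k + 1) ^ 2
  · obtain ⟨k, rfl⟩ := h
    obtain ⟨l, rfl⟩ := hodd
    have h1 : ∃ m : ℕ, (2 * l + 1) * ((2 * l + 1) * (2 * k + 1) ^ 2) = (2 * m + 1) ^ 2 :=
      ⟨2 * l * k + l + k, by ring⟩
    rw [if_pos (dvd_mul_right _ _), if_pos h1, Nat.mul_div_cancel_left _ hp0, if_pos ⟨k, rfl⟩]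
    exact CharTwo.add_self_eq_zero 1
  · have h1 : ¬ ∃ m : ℕ, p * n = (2 * m + 1) ^ 2 := fun h' => h (key h')
    rw [if_neg h1]
    split_ifs with hd hd'
    · exfalso
      obtain ⟨k, hk⟩ := hd'
      exact h ⟨k, by rw [← hk, Nat.mul_div_cancel' hd]⟩
    · simp
    · rfl

/-! ### Hecke operators on modular forms of level one -/

section ModularForms

open UpperHalfPlane MatrixGroups

local notation "𝕢" => Function.Periodic.qParam

lemma form_moebius {k : ℤ} (G : ModularForm 𝒮ℒ k) {a b c d : ℤ} (hdet : a * d - b * c = 1) {w v : ℂ}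
    (hw : 0 < w.im) (hv : v = (a * w + b) / (c * w + d)) :
    G (ofComplex v) = (c * w + d) ^ k * G (ofComplex w) := by
  let γ : SL(2, ℤ) := ⟨!![a, b; c, d], by rw [Matrix.det_fin_two_of, hdet]⟩
  let τ : ℍ := ⟨w, hw⟩
  have h1 : ((γ • τ : ℍ) : ℂ) = v := by
    rw [coe_specialLinearGroup_apply, hv]
    simp [γ, τ]
  have h2 := SlashInvariantForm.slash_action_eqn'' G
    (γ := Matrix.SpecialLinearGroup.mapGL ℝ γ)
    (show Matrix.SpecialLinearGroup.mapGL ℝ γ ∈ 𝒮ℒ from ⟨γ, rfl⟩) τ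
  rw [← h1, ofComplex_apply, show ofComplex w = τ from ofComplex_apply τ]
  refine h2.trans ?_
  change (((algebraMap ℤ ℝ c : ℝ) : ℂ) * w + ((algebraMap ℤ ℝ d : ℝ) : ℂ)) ^ k * G τ = _
  simp

lemma form_vadd_nat {k : ℤ} (G : ModularForm 𝒮ℒ k) (n : ℕ) {w : ℂ} (hw : 0 < w.im) :
    G (ofComplex (w + n)) = G (ofComplex w) := by
  have := form_moebius G (a := 1) (b := n) (c := 0) (d := 1) (by simp) hw (v := w + n) (by simp)
  simpa using this

lemma hasSum_form {k : ℤ} (G : ModularForm 𝒮ℒ k) {w : ℂ} (hw : 0 < w.im) :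
    HasSum (fun n => PowerSeries.coeff n (qExpansion 1 G) * 𝕢 1 w ^ n) (G (ofComplex w)) := by
  have h := ModularForm.hasSum_qExpansion G one_pos one_mem_strictPeriods_SL (⟨w, hw⟩ : ℍ)
  rwa [show ofComplex w = ⟨w, hw⟩ from ofComplex_apply_of_im_pos hw]

/-- The function `z ↦ p ^ K G(p z) + p⁻¹ ∑_{j < p} G((z + j) / p)` on the complex upper half-plane,
for a form `G` of weight `K + 1`. -/
noncomputable def heckeFun (p K : ℕ) (G : ℍ → ℂ) (z : ℂ) : ℂ :=
  (p : ℂ) ^ K * G (ofComplex (p * z)) +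
    (p : ℂ)⁻¹ * ∑ j ∈ Finset.range p, G (ofComplex ((z + j) / p))

section

variable {p : ℕ} {z : ℂ}

lemma im_nat_mul_pos (hp : 0 < p) (hz : 0 < z.im) : 0 < ((p : ℂ) * z).im := by
  simpa using mul_pos (Nat.cast_pos.mpr hp) hz

lemma im_add_nat_div_pos (hp : 0 < p) (hz : 0 < z.im) (j : ℕ) : 0 < ((z + j) / p).im := by
  rw [Complex.div_natCast_im]
  simpa using div_pos hz (Nat.cast_pos.mpr hp)

end

lemma heckeFun_add_one {p K : ℕ} (hp : 0 < p) {k : ℤ} (G : ModularForm 𝒮ℒ k) {z : ℂ}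
    (hz : 0 < z.im) : heckeFun p K G (z + 1) = heckeFun p K G z := by
  have hp' : (p : ℂ) ≠ 0 := Nat.cast_ne_zero.mpr hp.ne'
  unfold heckeFun
  congr 2
  · rw [mul_add, mul_one, form_vadd_nat G p (im_nat_mul_pos hp hz)]
  · have e : ∀ j : ℕ, (z + 1 + j) / (p : ℂ) = (z + (j + 1 : ℕ)) / p := fun j => by
      push_cast; ring
    simp only [e]
    have h := Finset.sum_range_succ' (fun j : ℕ => G (ofComplex ((z + j) / p))) p
    rw [Finset.sum_range_succ] at h
    have h0 : G (ofComplex ((z + p) / p)) = G (ofComplex ((z + (0 : ℕ)) / p)) := by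
      have := form_vadd_nat G 1 (im_add_nat_div_pos hp hz 0)
      rw [← this]
      congr 2
      push_cast
      field_simp
      ring
    rw [h0] at h
    exact (add_right_cancel h).symm

/-- Translation by `j ≠ 0` followed by inversion is matched with translation by `-j⁻¹` modulo `p`,
while `z ↦ p z` and `z ↦ z / p` are exchanged. -/
lemma heckeFun_inv {p K : ℕ} (hp : p.Prime) (G : ModularForm 𝒮ℒ ((K + 1 : ℕ) : ℤ)) {z : ℂ}
    (hz : 0 < z.im) : heckeFun p K G (-z)⁻¹ = z ^ (K + 1) * heckeFun p K G z := by
  have hp0 := hp.pos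
  have hp' : (p : ℂ) ≠ 0 := Nat.cast_ne_zero.mpr hp0.ne'
  have hz' : z ≠ 0 := by rintro rfl; simp at hz
  have : Fact p.Prime := ⟨hp⟩
  -- the terms `p z` and `z / p`
  have h1 : G (ofComplex (p * (-z)⁻¹)) = (z / p) ^ (K + 1) * G (ofComplex ((z + (0 : ℕ)) / p)) := by
    have := form_moebius G (a := 0) (b := -1) (c := 1) (d := 0) (by simp)
      (im_add_nat_div_pos hp0 hz 0) (v := p * (-z)⁻¹) (by simp; field_simp)
    rw [this, zpow_natCast]
    push_cast
    ring
  have h2 : G (ofComplex (((-z)⁻¹ + (0 : ℕ)) / p)) = (p * z) ^ (K + 1) * G (ofComplex (p * z)) := by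
    have := form_moebius G (a := 0) (b := -1) (c := 1) (d := 0) (by simp)
      (im_nat_mul_pos hp0 hz) (v := ((-z)⁻¹ + (0 : ℕ)) / p) (by push_cast; field_simp; ring)
    rw [this, zpow_natCast]
    push_cast
    ring
  -- the terms `(z + j) / p` with `j ≠ 0`
  have h3 : ∀ j i : ℕ, ((j : ZMod p)) * i = -1 → G (ofComplex (((-z)⁻¹ + j) / p)) =
      z ^ (K + 1) * G (ofComplex ((z + i) / p)) := by
    intro j i hij
    obtain ⟨m, hm⟩ : (p : ℤ) ∣ (j * i + 1 : ℤ) := by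
      rw [← ZMod.intCast_zmod_eq_zero_iff_dvd]
      push_cast
      rw [hij]
      ring
    have hm' : (j * i + 1 : ℂ) = p * m := by exact_mod_cast hm
    have := form_moebius G (a := j) (b := -m) (c := p) (d := -i) (by linear_combination -hm)
      (im_add_nat_div_pos hp0 hz i) (v := ((-z)⁻¹ + j) / p) (by
        have e1 : ((p : ℤ) : ℂ) * ((z + i) / p) + ((-i : ℤ) : ℂ) = z := by
          push_cast; field_simp; ring
        rw [e1]
        push_cast
        field_simp
        linear_combination -hm')
    rw [this, zpow_natCast]
    congr 2
    push_cast
    field_simp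
    ring
  have key : ∑ j ∈ (Finset.range p).erase 0, G (ofComplex (((-z)⁻¹ + j) / p)) =
      z ^ (K + 1) * ∑ j ∈ (Finset.range p).erase 0, G (ofComplex ((z + j) / p)) := by
    rw [Finset.mul_sum]
    have hinv : ∀ j ∈ (Finset.range p).erase 0,
        (j : ZMod p) * ((-(j : ZMod p)⁻¹).val : ℕ) = -1 ∧
        (-(j : ZMod p)⁻¹).val ∈ (Finset.range p).erase 0 ∧
        (-(((-(j : ZMod p)⁻¹).val : ℕ) : ZMod p)⁻¹).val = j := by
      intro j hj
      rw [Finset.mem_erase, Finset.mem_range] at hj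
      have hj0 : (j : ZMod p) ≠ 0 := by
        rw [Ne, ZMod.natCast_eq_zero_iff]
        exact fun h => hj.1 (Nat.eq_zero_of_dvd_of_lt h hj.2)
      refine ⟨?_, ?_, ?_⟩
      · rw [ZMod.natCast_zmod_val]
        field_simp
      · rw [Finset.mem_erase, Finset.mem_range]
        refine ⟨?_, ZMod.val_lt _⟩
        rw [Ne, ZMod.val_eq_zero]
        simpa using hj0
      · rw [ZMod.natCast_zmod_val, inv_neg, inv_inv, neg_neg, ZMod.val_natCast_of_lt hj.2]
    refine Finset.sum_nbij' (fun j => (-(j : ZMod p)⁻¹).val) (fun j => (-(j : ZMod p)⁻¹).val)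
      (fun j hj => (hinv j hj).2.1) (fun j hj => (hinv j hj).2.1)
      (fun j hj => (hinv j hj).2.2) (fun j hj => (hinv j hj).2.2) fun j hj => ?_
    exact h3 _ _ (hinv j hj).1
  unfold heckeFun
  rw [← Finset.add_sum_erase _ _ (Finset.mem_range.mpr hp0),
    ← Finset.add_sum_erase _ (fun j : ℕ => G (ofComplex ((z + j) / p))) (Finset.mem_range.mpr hp0),
    key, h1, h2, mul_pow, div_pow]
  field_simp
  ring

lemma sum_pow_root {p : ℕ} (hp : p.Prime) (n : ℕ) :
    ∑ j ∈ Finset.range p, Complex.exp (2 * Real.pi * Complex.I / p) ^ (j * n) =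
      if p ∣ n then (p : ℂ) else 0 := by
  have hprim := Complex.isPrimitiveRoot_exp p hp.ne_zero
  set ζ := Complex.exp (2 * Real.pi * Complex.I / p)
  have e : ∀ j, ζ ^ (j * n) = (ζ ^ n) ^ j := fun j => by rw [mul_comm, pow_mul]
  simp only [e]
  split_ifs with h
  · rw [(hprim.pow_eq_one_iff_dvd n).mpr h]
    simp
  · exact (hprim.pow_of_coprime n ((Nat.Prime.coprime_iff_not_dvd hp).mpr h).symm).geom_sum_eq_zero
      hp.one_lt

lemma hasSum_heckeFun {p K : ℕ} (hp : p.Prime) {k : ℤ} (G : ModularForm 𝒮ℒ k) {z : ℂ}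
    (hz : 0 < z.im) :
    HasSum (fun n => (PowerSeries.coeff (p * n) (qExpansion 1 G) +
      if p ∣ n then (p : ℂ) ^ K * PowerSeries.coeff (n / p) (qExpansion 1 G) else 0) * 𝕢 1 z ^ n)
      (heckeFun p K G z) := by
  have hp0 := hp.pos
  have hp' : (p : ℂ) ≠ 0 := Nat.cast_ne_zero.mpr hp0.ne'
  have hinj : Function.Injective (fun n : ℕ => p * n) := fun a b h =>
    Nat.eq_of_mul_eq_mul_left hp0 h
  have hrange : ∀ x, x ∉ Set.range (fun n : ℕ => p * n) → ¬ p ∣ x := by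
    rintro x hx ⟨y, rfl⟩
    exact hx ⟨y, rfl⟩
  set c := fun n => PowerSeries.coeff n (qExpansion 1 G) with hc
  have H1 : HasSum (fun n => (if p ∣ n then (p : ℂ) ^ K * c (n / p) else 0) * 𝕢 1 z ^ n)
      ((p : ℂ) ^ K * G (ofComplex (p * z))) := by
    rw [← hinj.hasSum_iff fun x hx => by rw [if_neg (hrange x hx), zero_mul]]
    have h := (hasSum_form G (im_nat_mul_pos hp0 hz)).mul_left ((p : ℂ) ^ K)
    have hq : 𝕢 1 (p * z) = 𝕢 1 z ^ p := by
      simp only [Function.Periodic.qParam]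
      rw [← Complex.exp_nat_mul]
      congr 1
      ring
    refine h.congr_fun fun n => ?_
    simp only [Function.comp, dvd_mul_right, if_true, Nat.mul_div_cancel_left _ hp0, hc]
    rw [hq, pow_mul, mul_assoc]
  have H2 : HasSum (fun n => c (p * n) * 𝕢 1 z ^ n)
      ((p : ℂ)⁻¹ * ∑ j ∈ Finset.range p, G (ofComplex ((z + j) / p))) := by
    have h := (hasSum_sum fun j (_ : j ∈ Finset.range p) =>
      hasSum_form G (im_add_nat_div_pos hp0 hz j)).mul_left (p : ℂ)⁻¹
    have hq : ∀ j n : ℕ, 𝕢 1 ((z + j) / p) ^ n =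
        𝕢 1 (z / p) ^ n * Complex.exp (2 * Real.pi * Complex.I / p) ^ (j * n) := by
      intro j n
      simp only [Function.Periodic.qParam]
      rw [← Complex.exp_nat_mul, ← Complex.exp_nat_mul, ← Complex.exp_nat_mul, ← Complex.exp_add]
      congr 1
      push_cast
      field_simp
    have hterm : ∀ n, (p : ℂ)⁻¹ * ∑ j ∈ Finset.range p, c n * 𝕢 1 ((z + j) / p) ^ n =
        if p ∣ n then c n * 𝕢 1 (z / p) ^ n else 0 := by
      intro n
      rw [← Finset.mul_sum]
      simp only [hq]
      rw [← Finset.mul_sum, sum_pow_root hp]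
      split_ifs
      · field_simp
      · simp
    simp only [hc] at hterm
    simp only [hterm] at h
    rw [← hinj.hasSum_iff fun x hx => by rw [if_neg (hrange x hx)]] at h
    refine h.congr_fun fun n => ?_
    simp only [Function.comp, dvd_mul_right, if_true, hc, pow_mul]
    congr 2
    simp only [Function.Periodic.qParam]
    rw [← Complex.exp_nat_mul]
    congr 1
    field_simp
  rw [heckeFun, add_comm]
  simp only [add_mul]
  exact H2.add H1

/-- The Hecke operator `T_p` on modular forms of level one and weight `K + 1`. -/
lemma exists_hecke_form {p K : ℕ} (hp : p.Prime) (G : ModularForm 𝒮ℒ ((K + 1 : ℕ) : ℤ)) :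
    ∃ H : ModularForm 𝒮ℒ ((K + 1 : ℕ) : ℤ), ∀ n, PowerSeries.coeff n (qExpansion 1 H) =
      PowerSeries.coeff (p * n) (qExpansion 1 G) +
        if p ∣ n then (p : ℂ) ^ K * PowerSeries.coeff (n / p) (qExpansion 1 G) else 0 := by
  have hp0 := hp.pos
  set f : ℍ → ℂ := fun z => heckeFun p K G z with hf
  have hT : SlashAction.map ((K + 1 : ℕ) : ℤ) ModularGroup.T f = f := by
    ext z
    rw [ModularForm.SL_slash_apply, UpperHalfPlane.modular_T_smul]
    have : ((1 : ℝ) +ᵥ z : ℍ) = ((z : ℂ) + 1) := by simp [add_comm]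
    simp only [hf]
    rw [this, heckeFun_add_one hp0 G z.im_pos]
    have hd : denom (Matrix.SpecialLinearGroup.toGL
        ((Matrix.SpecialLinearGroup.map (Int.castRingHom ℝ)) ModularGroup.T)) z = 1 := by
      change (((Int.castRingHom ℝ 0 : ℝ) : ℂ) * z + ((Int.castRingHom ℝ 1 : ℝ) : ℂ)) = 1
      simp
    rw [hd, one_zpow, mul_one]
  have hS : SlashAction.map ((K + 1 : ℕ) : ℤ) ModularGroup.S f = f := by
    ext z
    rw [ModularForm.SL_slash_apply, UpperHalfPlane.modular_S_smul]
    simp only [hf]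
    rw [heckeFun_inv hp G z.im_pos, ModularGroup.denom_S, zpow_neg, zpow_natCast, mul_comm,
      inv_mul_cancel_left₀ (pow_ne_zero _ z.ne_zero)]
  have hsl := SlashInvariantForm.slash_action_generators_SL2Z hS hT
  have hsum := fun z : ℍ => hasSum_heckeFun (K := K) hp G z.im_pos
  have hdiff : DifferentiableOn ℂ (G ∘ ofComplex) {z | 0 < z.im} :=
    UpperHalfPlane.mdifferentiable_iff.mp G.holo'
  let H : ModularForm 𝒮ℒ ((K + 1 : ℕ) : ℤ) :=
    { toFun := f
      slash_action_eq' := by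
        rintro A ⟨γ, rfl⟩
        exact hsl γ
      holo' := by
        rw [UpperHalfPlane.mdifferentiable_iff]
        have : DifferentiableOn ℂ (heckeFun p K G) {z | 0 < z.im} := by
          unfold heckeFun
          refine ((hdiff.comp (by fun_prop) fun z hz => im_nat_mul_pos hp0 hz).const_mul _).add
            (DifferentiableOn.const_mul (DifferentiableOn.fun_sum fun j _ => ?_) _)
          exact hdiff.comp (by fun_prop) fun z hz => im_add_nat_div_pos hp0 hz j
        refine this.congr fun z hz => ?_
        change f (ofComplex z) = _
        rw [ofComplex_apply_of_im_pos hz]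
      bdd_at_cusps' := by
        intro c hc
        rw [Subgroup.IsArithmetic.isCusp_iff_isCusp_SL2Z] at hc
        rw [OnePoint.isBoundedAt_iff_forall_SL2Z hc]
        intro γ _
        rw [hsl γ]
        exact isBoundedAtImInfty_of_hasSum_qExpansion one_pos hsum }
  exact ⟨H, fun n => (ModularFormClass.qExpansion_coeff_unique one_pos one_mem_strictPeriods_SL
    (f := H) hsum n).symm⟩

end ModularForms

/-! ### The discriminant modulo two -/

section Discriminant

open UpperHalfPlane MatrixGroups

/-- The power series `∑ σ_k(n) q ^ n`, the sum being over `n ≥ 1`. -/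
noncomputable def sigmaSeries (k : ℕ) : PowerSeries ℤ :=
  PowerSeries.mk fun n => (ArithmeticFunction.sigma k n : ℤ)

/-- The power series with coefficients `(5 σ_3(n) + 7 σ_5(n)) / 12`. -/
noncomputable def sigmaComb : PowerSeries ℤ :=
  PowerSeries.mk fun n => ∑ d ∈ n.divisors, (5 * (d : ℤ) ^ 3 + 7 * (d : ℤ) ^ 5) / 12

/-- The integral `q`-expansion of the modular discriminant, as given by
`1728 Δ = E₄ ^ 3 - E₆ ^ 2`. -/
noncomputable def discSeries : PowerSeries ℤ :=
  sigmaComb + 100 * sigmaSeries 3 ^ 2 + 8000 * sigmaSeries 3 ^ 3 - 147 * sigmaSeries 5 ^ 2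

lemma twelve_dvd (d : ℤ) : 12 ∣ 5 * d ^ 3 + 7 * d ^ 5 := by
  have h : ∀ x : ZMod 12, 5 * x ^ 3 + 7 * x ^ 5 = 0 := by decide
  have := (ZMod.intCast_zmod_eq_zero_iff_dvd (5 * d ^ 3 + 7 * d ^ 5) 12).mp
    (by push_cast; exact h d)
  exact_mod_cast this

lemma twelve_mul_sigmaComb : 12 * sigmaComb = 5 * sigmaSeries 3 + 7 * sigmaSeries 5 := by
  ext n
  have e : ∀ (m : ℕ) (f : PowerSeries ℤ),
      PowerSeries.coeff n ((m : PowerSeries ℤ) * f) = m * PowerSeries.coeff n f := fun m f => by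
    rw [← nsmul_eq_mul, map_nsmul, nsmul_eq_mul]
  have e12 := e 12 sigmaComb
  have e5 := e 5 (sigmaSeries 3)
  have e7 := e 7 (sigmaSeries 5)
  push_cast at e12 e5 e7
  rw [map_add, e12, e5, e7, sigmaComb, sigmaSeries, sigmaSeries, PowerSeries.coeff_mk,
    PowerSeries.coeff_mk, PowerSeries.coeff_mk, ArithmeticFunction.sigma_apply,
    ArithmeticFunction.sigma_apply]
  push_cast
  rw [Finset.mul_sum, Finset.mul_sum, Finset.mul_sum, ← Finset.sum_add_distrib]
  exact Finset.sum_congr rfl fun d _ => Int.mul_ediv_cancel' (twelve_dvd d)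

lemma map_eisenstein_four : (1 + 240 * sigmaSeries 3).map (Int.castRingHom ℂ) =
    qExpansion 1 ModularForm.E₄ := by
  ext n
  rw [EisensteinSeries.E_qExpansion_coeff _ (by decide), PowerSeries.coeff_map, map_add,
    PowerSeries.coeff_one, show (240 : PowerSeries ℤ) = PowerSeries.C 240 from
      (map_ofNat _ 240).symm,
    PowerSeries.coeff_C_mul, sigmaSeries, PowerSeries.coeff_mk]
  have hb : _root_.bernoulli 4 = -1 / 30 := by decide +kernel
  rw [hb]
  split_ifs with h
  · simp [h]
  · push_cast
    norm_num

lemma map_eisenstein_six : (1 - 504 * sigmaSeries 5).map (Int.castRingHom ℂ) =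
    qExpansion 1 ModularForm.E₆ := by
  ext n
  rw [EisensteinSeries.E_qExpansion_coeff _ (by decide), PowerSeries.coeff_map, map_sub,
    PowerSeries.coeff_one, show (504 : PowerSeries ℤ) = PowerSeries.C 504 from
      (map_ofNat _ 504).symm,
    PowerSeries.coeff_C_mul, sigmaSeries, PowerSeries.coeff_mk]
  have hb : _root_.bernoulli 6 = 1 / 42 := by decide +kernel
  rw [hb]
  split_ifs with h
  · simp [h]
  · push_cast
    norm_num

lemma map_discSeries : discSeries.map (Int.castRingHom ℂ) =
    qExpansion 1 ModularForm.discriminant := by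
  have h1 : (1728 : PowerSeries ℤ) * discSeries =
      (1 + 240 * sigmaSeries 3) ^ 3 - (1 - 504 * sigmaSeries 5) ^ 2 := by
    rw [discSeries]
    linear_combination 144 * twelve_mul_sigmaComb
  have h2 : (1728 : ℂ) • (CuspForm.discriminant : ℍ → ℂ) =
      (ModularForm.E₄.pow 3 : ℍ → ℂ) - (ModularForm.E₆.pow 2 : ℍ → ℂ) := by
    ext z
    simp only [CuspForm.coe_discriminant, Pi.smul_apply, Pi.sub_apply, ModularForm.coe_pow,
      Pi.pow_apply, ModularForm.discriminant_eq_E₄_cube_sub_E₆_sq, smul_eq_mul]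
    ring
  have h3 := congrArg (qExpansion 1) h2
  rw [ModularForm.qExpansion_smul one_pos one_mem_strictPeriods_SL,
    ModularForm.qExpansion_sub one_pos one_mem_strictPeriods_SL,
    ModularForm.qExpansion_pow one_pos one_mem_strictPeriods_SL,
    ModularForm.qExpansion_pow one_pos one_mem_strictPeriods_SL,
    ← map_eisenstein_four, ← map_eisenstein_six, ← map_pow, ← map_pow, ← map_sub, ← h1,
    map_mul, map_ofNat, PowerSeries.smul_eq_C_mul, map_ofNat] at h3
  have h1728 : (1728 : PowerSeries ℂ) ≠ 0 := by
    rw [show (1728 : PowerSeries ℂ) = PowerSeries.C 1728 from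
      (map_ofNat _ 1728).symm, Ne,
      map_eq_zero_iff _ PowerSeries.C_injective]
    norm_num
  exact (mul_left_cancel₀ h1728 h3).symm

lemma coeff_discSeries_zero : PowerSeries.coeff 0 discSeries = 0 := by
  have := congrArg (PowerSeries.coeff 0) map_discSeries
  rw [PowerSeries.coeff_map, ← CuspForm.coe_discriminant,
    CuspFormClass.qExpansion_coeff_zero _ one_pos one_mem_strictPeriods_SL] at this
  simpa using this

lemma coeff_discSeries_one : PowerSeries.coeff 1 discSeries = 1 := by
  have := congrArg (PowerSeries.coeff 1) map_discSeries
  rw [PowerSeries.coeff_map, ModularForm.discriminant_qExpansion_coeff_one] at this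
  simpa using this

/-- The divisors `d` and `n / d` cancel modulo two, except for a square root of `n`. -/
lemma sum_divisors_of_odd {n : ℕ} (hn : Odd n) [Decidable (IsSquare n)] :
    ∑ d ∈ n.divisors, (d : ZMod 2) = if IsSquare n then 1 else 0 := by
  have hn0 : n ≠ 0 := fun h => by simp [h] at hn
  have h1 : ∀ d ∈ n.divisors, (d : ZMod 2) = 1 := fun d hd =>
    ZMod.natCast_eq_one_iff_odd.mpr (Odd.of_dvd_nat hn (Nat.dvd_of_mem_divisors hd))
  rw [Finset.sum_congr rfl h1]
  have h2 : ∀ s : Finset ℕ, s ⊆ n.divisors → (∀ d ∈ s, n / d ∈ s) → (∀ d ∈ s, d * d ≠ n) →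
      ∑ d ∈ s, (1 : ZMod 2) = 0 := by
    intro s hs h3 h4
    refine Finset.sum_involution (fun d _ => n / d) (fun _ _ => by decide)
      (fun d hd _ h5 => h4 d hd ?_) h3 fun d hd =>
        Nat.div_div_self (Nat.dvd_of_mem_divisors (hs hd)) hn0
    have := Nat.div_mul_cancel (Nat.dvd_of_mem_divisors (hs hd))
    rwa [h5] at this
  have hdiv : ∀ d ∈ n.divisors, n / d ∈ n.divisors := fun d hd =>
    Nat.mem_divisors.mpr ⟨Nat.div_dvd_of_dvd (Nat.dvd_of_mem_divisors hd), hn0⟩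
  split_ifs with hsq
  · obtain ⟨r, rfl⟩ := hsq
    have hr : r ∈ (r * r).divisors := Nat.mem_divisors.mpr ⟨dvd_mul_right r r, hn0⟩
    rw [← Finset.add_sum_erase _ _ hr, h2 _ (Finset.erase_subset _ _), add_zero]
    · intro d hd
      rw [Finset.mem_erase] at hd ⊢
      refine ⟨fun h => hd.1 ?_, hdiv d hd.2⟩
      have h5 := Nat.div_mul_cancel (Nat.dvd_of_mem_divisors hd.2)
      rw [h] at h5
      exact Nat.eq_of_mul_eq_mul_left (Nat.pos_of_ne_zero fun h => hn0 (by simp [h])) h5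
    · intro d hd h
      exact (Finset.mem_erase.mp hd).1 (Nat.mul_self_inj.mp h)
  · exact h2 _ subset_rfl hdiv fun d _ h => hsq ⟨d, h.symm⟩

lemma sum_divisors_two_mul (k : ℕ) :
    ∑ d ∈ (2 * k).divisors, (d : ZMod 2) = ∑ d ∈ k.divisors, (d : ZMod 2) := by
  rcases eq_or_ne k 0 with rfl | hk
  · simp
  symm
  refine Finset.sum_subset (Nat.divisors_subset_of_dvd (by omega) (dvd_mul_left k 2)) ?_
  intro d hd hd'
  rw [ZMod.natCast_eq_zero_iff_even]
  by_contra hodd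
  rw [Nat.not_even_iff_odd] at hodd
  refine hd' (Nat.mem_divisors.mpr ⟨?_, hk⟩)
  exact (Nat.Coprime.dvd_mul_left (Nat.coprime_two_right.mpr hodd)).mp (Nat.dvd_of_mem_divisors hd)

lemma map_sigmaSeries_five : (sigmaSeries 5).map (Int.castRingHom (ZMod 2)) =
    PowerSeries.mk fun n => ∑ d ∈ n.divisors, (d : ZMod 2) := by
  have h : ∀ x : ZMod 2, x ^ 5 = x := by decide
  ext n
  simp [sigmaSeries, PowerSeries.coeff_map, ArithmeticFunction.sigma_apply, h]

lemma map_sigmaComb : sigmaComb.map (Int.castRingHom (ZMod 2)) =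
    PowerSeries.mk fun n => ∑ d ∈ n.divisors, (d : ZMod 2) := by
  have h : ∀ x : ZMod 24, 5 * x ^ 3 + 7 * x ^ 5 = 12 * x := by decide
  have key : ∀ d : ℤ, (((5 * d ^ 3 + 7 * d ^ 5) / 12 : ℤ) : ZMod 2) = d := by
    intro d
    have h1 : ((24 : ℕ) : ℤ) ∣ 5 * d ^ 3 + 7 * d ^ 5 - 12 * d := by
      rw [← ZMod.intCast_zmod_eq_zero_iff_dvd]
      push_cast
      rw [h, sub_self]
    have h2 := Int.mul_ediv_cancel' (twelve_dvd d)
    rw [← sub_eq_zero, ← Int.cast_sub, ZMod.intCast_zmod_eq_zero_iff_dvd]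
    push_cast at h1 ⊢
    omega
  ext n
  simp only [sigmaComb, PowerSeries.coeff_map, PowerSeries.coeff_mk, map_sum, eq_intCast, key]
  simp

lemma map_discSeries_two : discSeries.map (Int.castRingHom (ZMod 2)) = DeltaMod2 := by
  classical
  have h2 : (2 : PowerSeries (ZMod 2)) = 0 := by
    rw [show (2 : PowerSeries (ZMod 2)) = PowerSeries.C 2 from
      (map_ofNat _ 2).symm,
      show (2 : ZMod 2) = 0 from rfl, map_zero]
  have h3 : discSeries.map (Int.castRingHom (ZMod 2)) =
      sigmaComb.map (Int.castRingHom (ZMod 2)) +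
        (sigmaSeries 5).map (Int.castRingHom (ZMod 2)) ^ 2 := by
    simp only [discSeries, map_add, map_sub, map_mul, map_pow, map_ofNat]
    linear_combination (50 * (sigmaSeries 3).map (Int.castRingHom (ZMod 2)) ^ 2 +
      4000 * (sigmaSeries 3).map (Int.castRingHom (ZMod 2)) ^ 3 -
      74 * (sigmaSeries 5).map (Int.castRingHom (ZMod 2)) ^ 2) * h2
  rw [h3, map_sigmaComb, map_sigmaSeries_five, sq_eq_expand]
  ext n
  rw [map_add, PowerSeries.coeff_expand, coeff_Delta, PowerSeries.coeff_mk]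
  rcases Nat.even_or_odd' n with ⟨k, rfl | rfl⟩
  · rw [if_pos (dvd_mul_right 2 k), PowerSeries.coeff_mk, Nat.mul_div_cancel_left _ two_pos,
      sum_divisors_two_mul, CharTwo.add_self_eq_zero, if_neg]
    rintro ⟨m, hm⟩
    have : Odd (2 * k) := hm ▸ (odd_two_mul_add_one m).pow
    exact (Nat.not_even_iff_odd.mpr this) (even_two_mul k)
  · rw [if_neg (by omega), add_zero, sum_divisors_of_odd (odd_two_mul_add_one k)]
    congr 1
    rw [eq_iff_iff]
    constructor
    · rintro ⟨r, hr⟩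
      obtain ⟨m, rfl⟩ : Odd r := (Nat.odd_mul.mp (hr ▸ odd_two_mul_add_one k)).1
      exact ⟨m, by rw [hr, sq]⟩
    · rintro ⟨m, hm⟩
      exact ⟨2 * m + 1, by rw [hm, sq]⟩

/-- A form of weight `12 k` with integral `q`-expansion reduces modulo two to a polynomial of degree
at most `k` in `Δ`: since `E₄` is `1` modulo two, subtracting a multiple of `E₄ ^ (3 k)` changes
only the constant term, and the result is divisible by `Δ`. -/
lemma exists_polynomial_of_integral (k : ℕ) : ∀ (G : ModularForm 𝒮ℒ ((12 * k : ℕ) : ℤ))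
    (F : PowerSeries ℤ), F.map (Int.castRingHom ℂ) = qExpansion 1 G →
    ∃ P : (ZMod 2)[X], P.natDegree ≤ k ∧ F.map (Int.castRingHom (ZMod 2)) = formMod2 P := by
  have hinj : Function.Injective (PowerSeries.map (Int.castRingHom ℂ)) :=
    PowerSeries.map_injective _ Int.cast_injective
  induction k with
  | zero =>
    intro G F hF
    obtain ⟨c, hc⟩ := ModularFormClass.levelOne_weight_zero_const
      (ModularForm.mcast (by simp) G : ModularForm 𝒮ℒ 0)
    have hG : (G : ℍ → ℂ) = c • ((1 : ModularForm 𝒮ℒ 0) : ℍ → ℂ) := by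
      ext z
      simpa using congrFun hc z
    rw [hG, ModularForm.qExpansion_smul one_pos one_mem_strictPeriods_SL,
      ModularForm.qExpansion_one] at hF
    have hF' : F = PowerSeries.C (PowerSeries.coeff 0 F) := by
      ext n
      have := congrArg (PowerSeries.coeff n) hF
      rw [PowerSeries.coeff_C]
      split_ifs with h
      · rw [h]
      · simpa [PowerSeries.coeff_one, h] using this
    refine ⟨C ((PowerSeries.coeff 0 F : ℤ) : ZMod 2), by simp, ?_⟩
    rw [hF', PowerSeries.map_C, formMod2, aeval_C]
    simp
  | succ k ih =>
    intro G F hF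
    set a := PowerSeries.coeff 0 F with ha
    let E : ModularForm 𝒮ℒ ((12 * (k + 1) : ℕ) : ℤ) :=
      ModularForm.mcast (by push_cast; ring) (ModularForm.E₄.pow (3 * (k + 1)))
    have hE : qExpansion 1 E =
        ((1 + 240 * sigmaSeries 3) ^ (3 * (k + 1))).map (Int.castRingHom ℂ) := by
      rw [map_pow, map_eisenstein_four,
        ← ModularForm.qExpansion_pow one_pos one_mem_strictPeriods_SL]
      rfl
    have hs0 : PowerSeries.coeff 0 (sigmaSeries 3) = 0 := by simp [sigmaSeries]
    set e : PowerSeries ℤ := (1 + 240 * sigmaSeries 3) ^ (3 * (k + 1)) with he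
    have he0 : PowerSeries.constantCoeff e = 1 := by
      rw [PowerSeries.coeff_zero_eq_constantCoeff_apply] at hs0
      simp [he, hs0]
    set F' := F - PowerSeries.C a * e with hF'
    have hF'0 : PowerSeries.constantCoeff F' = 0 := by
      rw [PowerSeries.coeff_zero_eq_constantCoeff_apply] at ha
      simp [hF', he0, ha]
    set G' : ModularForm 𝒮ℒ ((12 * (k + 1) : ℕ) : ℤ) := G - (a : ℂ) • E with hGdef
    have hG' : qExpansion 1 G' = F'.map (Int.castRingHom ℂ) := by
      rw [hGdef, FunLike.coe_sub, ModularForm.qExpansion_sub one_pos one_mem_strictPeriods_SL,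
        FunLike.coe_smul, ModularForm.qExpansion_smul one_pos one_mem_strictPeriods_SL, hE, hF',
        map_sub, map_mul, PowerSeries.map_C, hF, PowerSeries.smul_eq_C_mul]
      rfl
    have hcusp : PowerSeries.coeff 0 (qExpansion 1 G') = 0 := by
      rw [hG', PowerSeries.coeff_map, PowerSeries.coeff_zero_eq_constantCoeff_apply, hF'0, map_zero]
    obtain ⟨U, hU⟩ := PowerSeries.X_dvd_iff.mpr
      ((PowerSeries.coeff_zero_eq_constantCoeff_apply _).symm.trans coeff_discSeries_zero)
    have hU0 : IsUnit U := by
      rw [PowerSeries.isUnit_iff_constantCoeff]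
      have := coeff_discSeries_one
      rw [hU, show (1 : ℕ) = 0 + 1 from rfl, PowerSeries.coeff_succ_X_mul,
        PowerSeries.coeff_zero_eq_constantCoeff_apply] at this
      rw [this]
      exact isUnit_one
    obtain ⟨F₁, hF₁⟩ : discSeries ∣ F' := by
      obtain ⟨F₂, hF₂⟩ := PowerSeries.X_dvd_iff.mpr hF'0
      rw [hU, hF₂]
      exact mul_dvd_mul_left _ (hU0.dvd)
    have hdiv := ModularForm.qExpansion_eq_qExpansion_discriminant_mul _ hcusp
    set G₁ := CuspForm.discriminantEquiv (G'.toCuspForm hcusp)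
    rw [hG', hF₁, map_mul, map_discSeries] at hdiv
    have hne : qExpansion 1 ModularForm.discriminant ≠ 0 := by
      rw [← map_discSeries, Ne, map_eq_zero_iff _ hinj]
      intro h
      have := coeff_discSeries_one
      simp [h] at this
    have hG₁ := mul_left_cancel₀ hne hdiv
    obtain ⟨P, hP, hPF⟩ := ih (ModularForm.mcast (by push_cast; ring) G₁) F₁
      (hG₁.trans (ModularForm.qExpansion_mcast _ _ _).symm)
    refine ⟨C (a : ZMod 2) + X * P, ?_, ?_⟩
    · refine (natDegree_add_le _ _).trans (max_le (by simp) ?_)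
      refine natDegree_mul_le.trans ?_
      rw [natDegree_X]
      omega
    · have hF2 : F = PowerSeries.C a * e + discSeries * F₁ := by rw [← hF₁, hF']; ring
      have he2 : e.map (Int.castRingHom (ZMod 2)) = 1 := by
        have h240 : (240 : PowerSeries (ZMod 2)) = 0 := by
          rw [show (240 : PowerSeries (ZMod 2)) = PowerSeries.C 240 from
      (map_ofNat _ 240).symm,
            show (240 : ZMod 2) = 0 from rfl, map_zero]
        rw [he, map_pow, map_add, map_mul, map_ofNat _ 240, h240, zero_mul,
          map_one, add_zero, one_pow]
      rw [hF2, map_add, map_mul, map_mul, he2, map_discSeries_two, hPF, PowerSeries.map_C]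
      simp only [formMod2, map_add, map_mul, aeval_X, aeval_C, mul_one]
      rfl

/-- Hecke operators preserve modular forms modulo two and do not raise the degree in `Δ`. -/
lemma exists_heckeT_Delta_pow {p : ℕ} (hp : p.Prime) (hodd : Odd p) (k : ℕ) :
    ∃ P : (ZMod 2)[X], P.natDegree ≤ k ∧ heckeT p (DeltaMod2 ^ k) = formMod2 P := by
  rcases Nat.eq_zero_or_pos k with rfl | hk
  · exact ⟨0, by simp, by simp [heckeT_one hp, formMod2]⟩
  obtain ⟨K, hK⟩ : ∃ K, 12 * k = K + 1 := ⟨12 * k - 1, by omega⟩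
  have hw : (k : ℤ) * 12 = ((K + 1 : ℕ) : ℤ) := by rw [← hK]; push_cast; ring
  let D : ModularForm 𝒮ℒ 12 := CuspForm.toModularFormₗ CuspForm.discriminant
  let G : ModularForm 𝒮ℒ ((K + 1 : ℕ) : ℤ) := ModularForm.mcast hw (D.pow k)
  have hG : qExpansion 1 G = (discSeries ^ k).map (Int.castRingHom ℂ) := by
    rw [map_pow, map_discSeries]
    exact ModularForm.qExpansion_pow one_pos one_mem_strictPeriods_SL D k
  obtain ⟨H, hH⟩ := exists_hecke_form hp G
  let F : PowerSeries ℤ := PowerSeries.mk fun n => PowerSeries.coeff (p * n) (discSeries ^ k) +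
    if p ∣ n then (p : ℤ) ^ K * PowerSeries.coeff (n / p) (discSeries ^ k) else 0
  have hF : F.map (Int.castRingHom ℂ) = qExpansion 1 H := by
    ext n
    rw [hH, hG, PowerSeries.coeff_map, PowerSeries.coeff_map, PowerSeries.coeff_map,
      PowerSeries.coeff_mk]
    split_ifs <;> simp
  obtain ⟨P, hP, hPF⟩ := exists_polynomial_of_integral k
    (ModularForm.mcast (by rw [hK]) H) F hF
  refine ⟨P, hP, ?_⟩
  rw [← hPF, ← map_discSeries_two, ← map_pow]
  have hp2 : (p : ZMod 2) = 1 := ZMod.natCast_eq_one_iff_odd.mpr hodd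
  ext n
  simp only [heckeT, F, PowerSeries.coeff_map, PowerSeries.coeff_mk]
  split_ifs <;> simp [hp2]

end Discriminant

/-! ### Polynomials in `Δ` -/

lemma coeff_Delta_of_lt {n : ℕ} (hn : n < 81) : PowerSeries.coeff n DeltaMod2 =
    if n = 1 ∨ n = 9 ∨ n = 25 ∨ n = 49 then 1 else 0 := by
  classical
  rw [coeff_Delta]
  congr 1
  rw [eq_iff_iff]
  constructor
  · rintro ⟨m, rfl⟩
    have : m < 4 := by nlinarith
    interval_cases m <;> simp
  · rintro (rfl | rfl | rfl | rfl)
    exacts [⟨0, rfl⟩, ⟨1, rfl⟩, ⟨2, rfl⟩, ⟨3, rfl⟩]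

lemma Delta_ne_zero : DeltaMod2 ≠ 0 := by
  intro h
  have := coeff_Delta_of_lt (n := 1) (by norm_num)
  simp [h] at this

lemma constantCoeff_Delta : PowerSeries.constantCoeff DeltaMod2 = 0 := by
  rw [← PowerSeries.coeff_zero_eq_constantCoeff_apply, coeff_Delta_of_lt (by norm_num)]
  simp

lemma formMod2_add (P Q : (ZMod 2)[X]) : formMod2 (P + Q) = formMod2 P + formMod2 Q := map_add _ _ _

lemma formMod2_mul (P Q : (ZMod 2)[X]) : formMod2 (P * Q) = formMod2 P * formMod2 Q := map_mul _ _ _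

lemma formMod2_pow (P : (ZMod 2)[X]) (n : ℕ) : formMod2 (P ^ n) = formMod2 P ^ n := map_pow _ _ _

lemma formMod2_X : formMod2 X = DeltaMod2 := aeval_X _

lemma formMod2_zero : formMod2 0 = 0 := map_zero _

lemma formMod2_one : formMod2 1 = 1 := map_one _

lemma eq_zero_of_formMod2_eq_zero (P : (ZMod 2)[X]) (h : formMod2 P = 0) : P = 0 := by
  induction hn : P.natDegree using Nat.strong_induction_on generalizing P with
  | _ n ih =>
    have e := X_mul_divX_add P
    have h0 : P.coeff 0 = 0 := by
      rw [← e, formMod2_add, formMod2_mul, formMod2_X] at h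
      have := congrArg PowerSeries.constantCoeff h
      simpa [formMod2, constantCoeff_Delta] using this
    rw [h0, map_zero, add_zero] at e
    rw [← e, formMod2_mul, formMod2_X] at h
    rcases Nat.eq_zero_or_pos n with rfl | hpos
    · rw [natDegree_eq_zero] at hn
      obtain ⟨a, rfl⟩ := hn
      rw [coeff_C_zero] at h0
      rw [h0, map_zero]
    · have := ih P.divX.natDegree (by rw [natDegree_divX_eq_natDegree_tsub_one]; omega) P.divX
        ((mul_eq_zero.mp h).resolve_left Delta_ne_zero) rfl
      rw [← e, this, mul_zero]

lemma formMod2_injective : Function.Injective formMod2 :=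
  (injective_iff_map_eq_zero (aeval DeltaMod2 : (ZMod 2)[X] →ₐ[ZMod 2] PowerSeries (ZMod 2))).mpr
    eq_zero_of_formMod2_eq_zero

lemma formMod2_eq_sum (P : (ZMod 2)[X]) :
    formMod2 P = ∑ j ∈ P.support, P.coeff j • DeltaMod2 ^ j := by
  rw [formMod2, aeval_def, eval₂_eq_sum, Polynomial.sum_def]
  simp only [Algebra.smul_def]

/-! ### Exponents modulo eight -/

/-- All exponents occurring in the power series `f` lie in the residue class `c` modulo `8`. -/
def SuppMod (c : ZMod 8) (f : PowerSeries (ZMod 2)) : Prop :=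
  ∀ n, PowerSeries.coeff n f ≠ 0 → (n : ZMod 8) = c

lemma SuppMod.mul {a b : ZMod 8} {f g : PowerSeries (ZMod 2)} (hf : SuppMod a f)
    (hg : SuppMod b g) : SuppMod (a + b) (f * g) := by
  intro n hn
  rw [PowerSeries.coeff_mul] at hn
  obtain ⟨⟨i, j⟩, hij, h⟩ := Finset.exists_ne_zero_of_sum_ne_zero hn
  rw [Finset.HasAntidiagonal.mem_antidiagonal] at hij
  rw [← hij, ← hf i (left_ne_zero_of_mul h), ← hg j (right_ne_zero_of_mul h)]
  push_cast
  rfl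

lemma suppMod_Delta_pow (k : ℕ) : SuppMod k (DeltaMod2 ^ k) := by
  classical
  induction k with
  | zero =>
    intro n hn
    rw [pow_zero, PowerSeries.coeff_one] at hn
    simp only [ne_eq, ite_eq_right_iff, Classical.not_imp] at hn
    rw [hn.1]
  | succ k ih =>
    rw [pow_succ, Nat.cast_succ]
    refine ih.mul fun n hn => ?_
    rw [coeff_Delta] at hn
    simp only [ne_eq, ite_eq_right_iff, Classical.not_imp] at hn
    obtain ⟨⟨m, rfl⟩, -⟩ := hn
    have : ∀ x : ZMod 8, (2 * x + 1) ^ 2 = 1 := by decide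
    push_cast
    exact this m

lemma SuppMod.heckeT {p : ℕ} (hodd : Odd p) {c : ZMod 8} {f : PowerSeries (ZMod 2)}
    (hf : SuppMod c f) : SuppMod (p * c) (heckeT p f) := by
  have hp : (p : ZMod 8) * p = 1 := by
    obtain ⟨m, rfl⟩ := hodd
    have : ∀ x : ZMod 8, (2 * x + 1) * (2 * x + 1) = 1 := by decide
    push_cast
    exact this m
  have h1 : ∀ n, PowerSeries.coeff (p * n) f ≠ 0 → (n : ZMod 8) = p * c := fun n hn => by
    rw [← hf _ hn]
    push_cast
    rw [← mul_assoc, hp, one_mul]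
  intro n hn
  rw [_root_.heckeT, PowerSeries.coeff_mk] at hn
  split_ifs at hn with h
  · by_cases h2 : PowerSeries.coeff (p * n) f = 0
    · rw [h2, zero_add] at hn
      rw [← hf _ hn, ← Nat.cast_mul, Nat.mul_div_cancel' h]
    · exact h1 n h2
  · exact h1 n hn

/-- A polynomial in `Δ` whose exponents in `q` lie in the class `c` modulo `8` only involves powers
of `Δ` in that class. -/
lemma natCast_eq_of_suppMod {P : (ZMod 2)[X]} {c : ZMod 8} (h : SuppMod c (formMod2 P)) {j : ℕ}
    (hj : P.coeff j ≠ 0) : (j : ZMod 8) = c := by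
  classical
  -- the part of `P` outside the class `c` gives the zero series
  let Q : (ZMod 2)[X] :=
    ∑ i ∈ P.support.filter fun i : ℕ => (i : ZMod 8) ≠ c, monomial i (P.coeff i)
  have hQ : formMod2 Q =
      ∑ i ∈ P.support.filter fun i : ℕ => (i : ZMod 8) ≠ c, P.coeff i • DeltaMod2 ^ i := by
    simp only [Q, formMod2, map_sum, aeval_monomial, Algebra.smul_def]
  have hsplit : formMod2 P =
      (∑ i ∈ P.support.filter fun i : ℕ => (i : ZMod 8) = c, P.coeff i • DeltaMod2 ^ i) +
      formMod2 Q := by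
    rw [hQ, formMod2_eq_sum, Finset.sum_filter_add_sum_filter_not]
  have hz : formMod2 Q = 0 := by
    ext n
    rw [map_zero]
    by_cases hn : (n : ZMod 8) = c
    · rw [hQ, map_sum]
      refine Finset.sum_eq_zero fun i hi => ?_
      by_contra hne
      rw [map_smul] at hne
      exact (Finset.mem_filter.mp hi).2
        ((suppMod_Delta_pow i n (right_ne_zero_of_mul hne)).symm.trans hn)
    · have h1 : PowerSeries.coeff n (formMod2 P) = 0 := by
        by_contra h2
        exact hn (h n h2)
      rw [hsplit, map_add, map_sum, Finset.sum_eq_zero, zero_add] at h1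
      · exact h1
      · intro i hi
        by_contra hne
        rw [map_smul] at hne
        exact hn ((suppMod_Delta_pow i n (right_ne_zero_of_mul hne)).trans
          (Finset.mem_filter.mp hi).2)
  by_contra hjc
  have := congrArg (fun R => coeff R j) (eq_zero_of_formMod2_eq_zero Q hz)
  simp only [Q, finsetSum_coeff, coeff_monomial, coeff_zero] at this
  rw [Finset.sum_ite_eq' _ j, if_pos] at this
  · exact hj this
  · exact Finset.mem_filter.mpr ⟨mem_support_iff.mpr hj, hjc⟩

/-- The form `T_p Δ ^ k` is a polynomial in `Δ` of degree at most `k` whose exponents are congruent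
to `p k` modulo `8`. -/
lemma exists_heckeT_Delta_pow_mod {p : ℕ} (hp : p.Prime) (hodd : Odd p) (k : ℕ) :
    ∃ P : (ZMod 2)[X], (∀ j, P.coeff j ≠ 0 → j ≤ k ∧ (j : ZMod 8) = p * k) ∧
      heckeT p (DeltaMod2 ^ k) = formMod2 P := by
  obtain ⟨P, hP, h⟩ := exists_heckeT_Delta_pow hp hodd k
  refine ⟨P, fun j hj => ⟨(le_natDegree_of_ne_zero hj).trans hP, ?_⟩, h⟩
  exact natCast_eq_of_suppMod (h ▸ (suppMod_Delta_pow k).heckeT hodd) hj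

/-! ### The recurrence for `T_p Δ ^ k` -/

/-- Multiplication by `f` on `𝔽₂⟦q⟧`, a free module with basis `1, q, …, q ^ (p - 1)` over
`𝔽₂⟦q ^ p⟧`, is annihilated by its characteristic polynomial. -/
lemma exists_monic_eval_expand {p : ℕ} (hp : p ≠ 0) (f : PowerSeries (ZMod 2)) :
    ∃ χ : Polynomial (PowerSeries (ZMod 2)), χ.Monic ∧ χ.natDegree = p ∧
      eval f (χ.map (PowerSeries.expand (R := ZMod 2) p hp).toRingHom) = 0 := by
  let M : Matrix (Fin p) (Fin p) (PowerSeries (ZMod 2)) := fun i j =>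
    sect p i (f * PowerSeries.X ^ (j : ℕ))
  refine ⟨M.charpoly, Matrix.charpoly_monic M,
    (Matrix.charpoly_natDegree_eq_dim M).trans (Fintype.card_fin p), ?_⟩
  rw [← Matrix.charpoly_map, Matrix.eval_charpoly, ← Matrix.exists_vecMul_eq_zero_iff]
  refine ⟨fun i => PowerSeries.X ^ (i : ℕ), fun h => ?_, ?_⟩
  · exact pow_ne_zero 0 PowerSeries.X_ne_zero (congrFun h ⟨0, Nat.pos_of_ne_zero hp⟩)
  · rw [Matrix.vecMul_sub, sub_eq_zero]
    ext1 j
    rw [Matrix.scalar_apply, Matrix.vecMul_diagonal, mul_comm,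
      eq_sum_expand_sect hp (f * PowerSeries.X ^ (j : ℕ)), Matrix.vecMul, dotProduct]
    exact Finset.sum_congr rfl fun i _ => mul_comm _ _

lemma two_eq_zero_powerSeries : (2 : PowerSeries (ZMod 2)) = 0 := by
  rw [show (2 : PowerSeries (ZMod 2)) = PowerSeries.C 2 from (map_ofNat _ 2).symm,
    show (2 : ZMod 2) = 0 from rfl, map_zero]

/-- The series `T_p f ^ k`, for varying `k`, satisfy a linear recurrence of order `p + 1`. Its
characteristic polynomial is the product of that of multiplication by `f` on `𝔽₂⟦q⟧` over
`𝔽₂⟦q ^ p⟧`, and of `Y - f(q ^ p)`. -/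
lemma exists_recurrence {p : ℕ} (hp : p ≠ 0) (f : PowerSeries (ZMod 2)) :
    ∃ e : ℕ → PowerSeries (ZMod 2), ∀ k, heckeT p (f ^ (k + (p + 1))) =
      ∑ i ∈ Finset.range (p + 1), e i * heckeT p (f ^ (k + i)) := by
  obtain ⟨χ, hmonic, hdegχ, hχ⟩ := exists_monic_eval_expand hp f
  set V : PowerSeries (ZMod 2) →+* PowerSeries (ZMod 2) := 
    (PowerSeries.expand p hp).toRingHom
  have hV : ∀ g, V g = PowerSeries.expand p hp g := fun _ => rfl
  -- the functional sending `Y ^ i` to `T_p f ^ i`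
  let Λ : Polynomial (PowerSeries (ZMod 2)) →+ PowerSeries (ZMod 2) :=
    { toFun := fun q => sect p 0 (eval f (q.map V)) + eval (V f) q
      map_zero' := by simp
      map_add' := fun q r => by
        simp only [Polynomial.map_add, eval_add, map_add]
        ring }
  have hΛdef : ∀ q, Λ q = sect p 0 (eval f (q.map V)) + eval (V f) q := fun _ => rfl
  have hΛ : ∀ c i, Λ (C c * X ^ i) = c * heckeT p (f ^ i) := by
    intro c i
    rw [hΛdef, Polynomial.map_mul, Polynomial.map_pow, map_C, map_X, eval_mul, eval_C, eval_pow,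
      eval_X, eval_mul, eval_C, eval_pow, eval_X, hV c, sect_expand_mul, heckeT_eq hp, hV f,
      map_pow (PowerSeries.expand p hp), mul_add]
  obtain ⟨Q, hQ, hdeg, hΛQ⟩ : ∃ Q : Polynomial (PowerSeries (ZMod 2)), Q.Monic ∧
      Q.natDegree = p + 1 ∧ ∀ k, Λ (Q * X ^ k) = 0 := by
    refine ⟨χ * (X - C (V f)), hmonic.mul (monic_X_sub_C _), ?_, fun k => ?_⟩
    · rw [hmonic.natDegree_mul (monic_X_sub_C _), hdegχ, natDegree_X_sub_C]
    · rw [hΛdef, Polynomial.map_mul, Polynomial.map_mul, eval_mul, eval_mul, hχ, eval_mul,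
        eval_mul, eval_sub, eval_X, eval_C, sub_self]
      simp
  have hΛ1 : ∀ i, Λ (X ^ i) = heckeT p (f ^ i) := fun i => by
    have := hΛ 1 i
    rwa [C_1, one_mul, one_mul] at this
  clear_value Λ
  refine ⟨Q.coeff, fun k => ?_⟩
  have hexp : Q * X ^ k = X ^ (k + (p + 1)) +
      ∑ i ∈ Finset.range (p + 1), C (Q.coeff i) * X ^ (k + i) := by
    conv_lhs => rw [hQ.as_sum, hdeg]
    rw [add_mul, Finset.sum_mul, ← pow_add, add_comm (p + 1) k]
    exact congrArg _ (Finset.sum_congr rfl fun i _ => by rw [mul_assoc, ← pow_add, add_comm i k])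
  have h := hΛQ k
  rw [hexp, map_add, hΛ1, map_sum] at h
  simp only [hΛ] at h
  linear_combination h - (∑ i ∈ Finset.range (p + 1), Q.coeff i * heckeT p (f ^ (k + i))) *
    two_eq_zero_powerSeries

/-! ### The operators `T_3` and `T_5` -/

/-- Truncated expansions of the powers of `Δ` needed for the initial values of `T_3` and `T_5`. -/
lemma Delta_pow_expansions :
    (∃ W, DeltaMod2 ^ 3 = PowerSeries.X ^ 3 + PowerSeries.X ^ 11 * W) ∧
    (∃ W, DeltaMod2 ^ 5 = PowerSeries.X ^ 5 + PowerSeries.X ^ 13 * W) ∧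
    (∃ W, DeltaMod2 ^ 7 = PowerSeries.X ^ 7 + PowerSeries.X ^ 15 + PowerSeries.X ^ 23 * W) ∧
    (∃ W, DeltaMod2 ^ 9 = PowerSeries.X ^ 9 + PowerSeries.X ^ 17 + PowerSeries.X ^ 33 * W) ∧
    ∃ W, DeltaMod2 ^ 11 = PowerSeries.X ^ 11 + PowerSeries.X ^ 19 + PowerSeries.X ^ 27 +
      PowerSeries.X ^ 43 * W := by
  obtain ⟨S, hS⟩ : ∃ S, DeltaMod2 = PowerSeries.X *
      (1 + PowerSeries.X ^ 8 + PowerSeries.X ^ 24 + PowerSeries.X ^ 48 * S) := by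
    have h : PowerSeries.X ^ 49 ∣ DeltaMod2 - (PowerSeries.X + PowerSeries.X ^ 9 +
        PowerSeries.X ^ 25) := by
      rw [PowerSeries.X_pow_dvd_iff]
      intro m hm
      rw [map_sub, coeff_Delta_of_lt (by omega), map_add, map_add, PowerSeries.coeff_X,
        PowerSeries.coeff_X_pow, PowerSeries.coeff_X_pow]
      rcases eq_or_ne m 1 with rfl | h1
      · simp
      rcases eq_or_ne m 9 with rfl | h2
      · simp
      rcases eq_or_ne m 25 with rfl | h3
      · simp
      simp [h1, h2, h3, show m ≠ 49 by omega]
    obtain ⟨S, hS⟩ := h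
    exact ⟨S, by linear_combination hS⟩
  set Z : PowerSeries (ZMod 2) := PowerSeries.X ^ 8 with hZ
  set U := 1 + Z + Z ^ 3 + Z ^ 6 * S with hU
  have hD : DeltaMod2 = PowerSeries.X * U := by rw [hS, hU, hZ]; ring
  have h2 := two_eq_zero_powerSeries
  have hsq : ∀ a b : PowerSeries (ZMod 2), (a + b) ^ 2 = a ^ 2 + b ^ 2 := fun a b => by
    linear_combination a * b * h2
  have hU2 : U ^ 2 = 1 + Z ^ 2 * (1 + Z ^ 4 * (1 + Z ^ 6 * S ^ 2)) := by
    rw [hU, hsq, hsq, hsq]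
    ring
  have hU4 : U ^ 4 = 1 + Z ^ 4 * (1 + Z ^ 4 * (1 + Z ^ 6 * S ^ 2)) ^ 2 := by
    rw [show U ^ 4 = (U ^ 2) ^ 2 by ring, hU2, hsq]
    ring
  have hU8 : U ^ 8 = 1 + Z ^ 8 * (1 + Z ^ 4 * (1 + Z ^ 6 * S ^ 2)) ^ 4 := by
    rw [show U ^ 8 = (U ^ 4) ^ 2 by ring, hU4, hsq]
    ring
  have hU3 : ∃ W, U ^ 3 = 1 + Z + Z ^ 2 + Z ^ 4 * W := by
    refine ⟨Z ^ 2 * S + Z * (1 + Z ^ 3 * S) + Z ^ 2 * (1 + Z ^ 6 * S ^ 2) *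
      (1 + Z + Z ^ 3 * (1 + Z ^ 3 * S)), ?_⟩
    rw [show U ^ 3 = U ^ 2 * U by ring, hU2, hU]
    linear_combination Z ^ 3 * h2
  obtain ⟨W, hW⟩ := hU3
  set A := 1 + Z ^ 4 * (1 + Z ^ 6 * S ^ 2)
  clear_value A U
  refine ⟨⟨1 + Z + Z ^ 3 * W, ?_⟩, ⟨1 + Z ^ 2 + Z ^ 5 * S + Z ^ 3 * A ^ 2 * U, ?_⟩,
    ⟨1 + Z ^ 2 * W + Z ^ 2 * A ^ 2 * U ^ 3, ?_⟩, ⟨1 + Z ^ 3 * S + Z ^ 5 * A ^ 4 * U, ?_⟩,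
    ⟨W + Z ^ 4 * A ^ 4 * U ^ 3, ?_⟩⟩
  · rw [hD, mul_pow, hW, hZ]; ring
  · rw [hD, mul_pow, show U ^ 5 = U ^ 4 * U by ring, hU4, add_mul, one_mul]
    nth_rw 1 [hU]
    rw [hZ]; ring
  · rw [hD, mul_pow, show U ^ 7 = U ^ 4 * U ^ 3 by ring, hU4, add_mul, one_mul]
    nth_rw 1 [hW]
    rw [hZ]; ring
  · rw [hD, mul_pow, show U ^ 9 = U ^ 8 * U by ring, hU8, add_mul, one_mul]
    nth_rw 1 [hU]
    rw [hZ]; ring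
  · rw [hD, mul_pow, show U ^ 11 = U ^ 8 * U ^ 3 by ring, hU8, add_mul, one_mul]
    nth_rw 1 [hW]
    rw [hZ]; ring

/-- If only one exponent is allowed in `T_p Δ ^ k`, this form is a multiple of a power of `Δ`,
determined by one coefficient. -/
lemma heckeT_Delta_pow_eq {p : ℕ} (hp : p.Prime) (hodd : Odd p) (k m : ℕ)
    (hm : ∀ j ≤ k, (j : ZMod 8) = p * k → j = m) :
    heckeT p (DeltaMod2 ^ k) =
      PowerSeries.coeff m (heckeT p (DeltaMod2 ^ k)) • DeltaMod2 ^ m := by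
  obtain ⟨P, hP, h⟩ := exists_heckeT_Delta_pow_mod hp hodd k
  have hPm : P = C (P.coeff m) * X ^ m := by
    ext j
    rw [coeff_C_mul_X_pow]
    split_ifs with hj
    · rw [hj]
    · by_contra hne
      exact hj (hm j (hP j hne).1 (hP j hne).2)
  have h' : heckeT p (DeltaMod2 ^ k) = P.coeff m • DeltaMod2 ^ m := by
    rw [h, hPm, formMod2_mul, formMod2_pow, formMod2_X, coeff_C_mul_X_pow, if_pos rfl, formMod2,
      aeval_C, Algebra.smul_def]
  have hlead : PowerSeries.coeff m (DeltaMod2 ^ m) = 1 := by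
    have : ∃ S, DeltaMod2 = PowerSeries.X * S ∧ PowerSeries.constantCoeff S = 1 := by
      obtain ⟨S, hS⟩ := PowerSeries.X_dvd_iff.mpr constantCoeff_Delta
      refine ⟨S, hS, ?_⟩
      have := coeff_Delta_of_lt (n := 1) (by norm_num)
      rw [hS, show (1 : ℕ) = 0 + 1 from rfl, PowerSeries.coeff_succ_X_mul] at this
      simpa using this
    obtain ⟨S, hS, hS1⟩ := this
    rw [hS, mul_pow, PowerSeries.coeff_X_pow_mul', if_pos le_rfl, Nat.sub_self,
      PowerSeries.coeff_zero_eq_constantCoeff_apply, map_pow, hS1, one_pow]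
  rw [h', map_smul, hlead, smul_eq_mul, mul_one]

lemma heckeT_Delta_pow_eq_zero {p : ℕ} (hp : p.Prime) (hodd : Odd p) (k : ℕ)
    (hm : ∀ j ≤ k, (j : ZMod 8) ≠ p * k) : heckeT p (DeltaMod2 ^ k) = 0 := by
  obtain ⟨P, hP, h⟩ := exists_heckeT_Delta_pow_mod hp hodd k
  have : P = 0 := by
    ext j
    by_contra hne
    exact hm j (hP j hne).1 (hP j hne).2
  rw [h, this, formMod2_zero]

/-- The values `T_3 Δ ^ k` for `k < 8`. -/
lemma heckeT_three_values : ∀ k < 8, heckeT 3 (DeltaMod2 ^ k) =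
    if k = 3 then DeltaMod2 else if k = 6 then DeltaMod2 ^ 2 else
      if k = 7 then DeltaMod2 ^ 5 else 0 := by
  have hp : Nat.Prime 3 := by norm_num
  have ho : Odd 3 := by decide
  obtain ⟨⟨W3, h3⟩, -, ⟨W7, h7⟩, -, -⟩ := Delta_pow_expansions
  have s0 : heckeT 3 (DeltaMod2 ^ 0) = 0 := by rw [pow_zero, heckeT_one hp]
  have s1 : heckeT 3 (DeltaMod2 ^ 1) = 0 := by rw [pow_one, heckeT_Delta hp ho]
  have sq : ∀ k, heckeT 3 (DeltaMod2 ^ (2 * k)) = heckeT 3 (DeltaMod2 ^ k) ^ 2 := fun k => by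
    rw [mul_comm, pow_mul, heckeT_sq hp ho]
  have s2 : heckeT 3 (DeltaMod2 ^ 2) = 0 := by rw [sq 1, s1]; simp
  have s4 : heckeT 3 (DeltaMod2 ^ 4) = 0 := by rw [sq 2, s2]; simp
  have s3 : heckeT 3 (DeltaMod2 ^ 3) = DeltaMod2 := by
    have h := heckeT_Delta_pow_eq hp ho 3 1 (by decide)
    rw [h, heckeT, PowerSeries.coeff_mk, h3]
    simp [PowerSeries.coeff_X_pow, PowerSeries.coeff_X_pow_mul']
  have s5 : heckeT 3 (DeltaMod2 ^ 5) = 0 := heckeT_Delta_pow_eq_zero hp ho 5 (by decide)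
  have s6 : heckeT 3 (DeltaMod2 ^ 6) = DeltaMod2 ^ 2 := by rw [sq 3, s3]
  have s7 : heckeT 3 (DeltaMod2 ^ 7) = DeltaMod2 ^ 5 := by
    have h := heckeT_Delta_pow_eq hp ho 7 5 (by decide)
    rw [h, heckeT, PowerSeries.coeff_mk, h7]
    simp [PowerSeries.coeff_X_pow, PowerSeries.coeff_X_pow_mul']
  intro k hk
  interval_cases k <;> simp_all

/-- The values `T_5 Δ ^ k` for `k < 12`. -/
lemma heckeT_five_values : ∀ k < 12, heckeT 5 (DeltaMod2 ^ k) =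
    if k = 5 then DeltaMod2 else if k = 7 then DeltaMod2 ^ 3 else
      if k = 10 then DeltaMod2 ^ 2 else 0 := by
  have hp : Nat.Prime 5 := by norm_num
  have ho : Odd 5 := by decide
  obtain ⟨-, ⟨W5, h5⟩, ⟨W7, h7⟩, ⟨W9, h9⟩, ⟨W11, h11⟩⟩ := Delta_pow_expansions
  have s0 : heckeT 5 (DeltaMod2 ^ 0) = 0 := by rw [pow_zero, heckeT_one hp]
  have s1 : heckeT 5 (DeltaMod2 ^ 1) = 0 := by rw [pow_one, heckeT_Delta hp ho]
  have sq : ∀ k, heckeT 5 (DeltaMod2 ^ (2 * k)) = heckeT 5 (DeltaMod2 ^ k) ^ 2 := fun k => by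
    rw [mul_comm, pow_mul, heckeT_sq hp ho]
  have s2 : heckeT 5 (DeltaMod2 ^ 2) = 0 := by rw [sq 1, s1]; simp
  have s4 : heckeT 5 (DeltaMod2 ^ 4) = 0 := by rw [sq 2, s2]; simp
  have s8 : heckeT 5 (DeltaMod2 ^ 8) = 0 := by rw [sq 4, s4]; simp
  have s3 : heckeT 5 (DeltaMod2 ^ 3) = 0 := heckeT_Delta_pow_eq_zero hp ho 3 (by decide)
  have s6 : heckeT 5 (DeltaMod2 ^ 6) = 0 := by rw [sq 3, s3]; simp
  have s5 : heckeT 5 (DeltaMod2 ^ 5) = DeltaMod2 := by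
    have h := heckeT_Delta_pow_eq hp ho 5 1 (by decide)
    rw [h, heckeT, PowerSeries.coeff_mk, h5]
    simp [PowerSeries.coeff_X_pow, PowerSeries.coeff_X_pow_mul']
  have s10 : heckeT 5 (DeltaMod2 ^ 10) = DeltaMod2 ^ 2 := by rw [sq 5, s5]
  have s7 : heckeT 5 (DeltaMod2 ^ 7) = DeltaMod2 ^ 3 := by
    have h := heckeT_Delta_pow_eq hp ho 7 3 (by decide)
    rw [h, heckeT, PowerSeries.coeff_mk, h7]
    simp [PowerSeries.coeff_X_pow, PowerSeries.coeff_X_pow_mul']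
  have s9 : heckeT 5 (DeltaMod2 ^ 9) = 0 := by
    have h := heckeT_Delta_pow_eq hp ho 9 5 (by decide)
    rw [h, heckeT, PowerSeries.coeff_mk, h9]
    simp [PowerSeries.coeff_X_pow, PowerSeries.coeff_X_pow_mul']
  have s11 : heckeT 5 (DeltaMod2 ^ 11) = 0 := by
    have h := heckeT_Delta_pow_eq hp ho 11 7 (by decide)
    rw [h, heckeT, PowerSeries.coeff_mk, h11]
    simp [PowerSeries.coeff_X_pow, PowerSeries.coeff_X_pow_mul']
  intro k hk
  interval_cases k <;> simp_all

/-- The initial values of `T_3 Δ ^ k` determine the four coefficients of its recurrence. -/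
lemma heckeT_three_rec (k : ℕ) : heckeT 3 (DeltaMod2 ^ (k + 4)) =
    DeltaMod2 * heckeT 3 (DeltaMod2 ^ (k + 1)) + DeltaMod2 ^ 4 * heckeT 3 (DeltaMod2 ^ k) := by
  obtain ⟨e, he⟩ := exists_recurrence (p := 3) (by norm_num) DeltaMod2
  have v := heckeT_three_values
  have z0 := heckeT_one (p := 3) (by norm_num)
  have z1 := heckeT_Delta (p := 3) (by norm_num) (by decide)
  simp only [Finset.sum_range_succ, Finset.sum_range_zero, zero_add, Nat.reduceAdd] at he
  have e3 : e 3 = 0 := by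
    simpa [v, z0, z1, Delta_ne_zero] using he 0
  have e2 : e 2 = 0 := by
    simpa [v, z0, z1, Delta_ne_zero, e3] using he 1
  have e1 : e 1 = DeltaMod2 := by
    have := he 2
    simp [v, e3, e2] at this
    exact mul_right_cancel₀ Delta_ne_zero (by linear_combination -this)
  have e0 : e 0 = DeltaMod2 ^ 4 := by
    have := he 3
    simp [v, e3, e2] at this
    exact mul_right_cancel₀ Delta_ne_zero (by linear_combination -this)
  rw [he, e0, e1, e2, e3, add_zero]
  ring

/-- The initial values of `T_5 Δ ^ k` determine the six coefficients of its recurrence. -/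
lemma heckeT_five_rec (k : ℕ) : heckeT 5 (DeltaMod2 ^ (k + 6)) =
    DeltaMod2 ^ 2 * heckeT 5 (DeltaMod2 ^ (k + 4)) +
      DeltaMod2 ^ 4 * heckeT 5 (DeltaMod2 ^ (k + 2)) +
      DeltaMod2 * heckeT 5 (DeltaMod2 ^ (k + 1)) + DeltaMod2 ^ 6 * heckeT 5 (DeltaMod2 ^ k) := by
  obtain ⟨e, he⟩ := exists_recurrence (p := 5) (by norm_num) DeltaMod2
  have v := heckeT_five_values
  have h2 := two_eq_zero_powerSeries
  have z0 := heckeT_one (p := 5) (by norm_num)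
  have z1 := heckeT_Delta (p := 5) (by norm_num) (by decide)
  simp only [Finset.sum_range_succ, Finset.sum_range_zero, zero_add, Nat.reduceAdd] at he
  have e5 : e 5 = 0 := by
    simpa [v, z0, z1, Delta_ne_zero] using he 0
  have e4 : e 4 = DeltaMod2 ^ 2 := by
    have := he 1
    simp [v, z1, e5] at this
    exact mul_right_cancel₀ Delta_ne_zero (by linear_combination -this)
  have e3 : e 3 = 0 := by
    simpa [v, z0, z1, Delta_ne_zero, e5] using he 2
  have e2 : e 2 = DeltaMod2 ^ 4 := by
    have := he 3
    simp [v, e5, e4, e3] at this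
    refine mul_right_cancel₀ Delta_ne_zero ?_
    linear_combination -this - DeltaMod2 ^ 5 * h2
  have e1 : e 1 = DeltaMod2 := by
    have := he 4
    simp [v, e5, e4, e3] at this
    exact mul_right_cancel₀ Delta_ne_zero (by linear_combination -this)
  have e0 : e 0 = DeltaMod2 ^ 6 := by
    have := he 5
    simp [v, e5, e4, e3, e2] at this
    refine mul_right_cancel₀ Delta_ne_zero ?_
    linear_combination -this - DeltaMod2 ^ 7 * h2
  rw [he, e0, e1, e2, e3, e4, e5, add_zero]
  ring

lemma heckeT_formMod2 {p : ℕ} (c : (ZMod 2)[X] →ₗ[ZMod 2] (ZMod 2)[X])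
    (h : ∀ k, heckeT p (DeltaMod2 ^ k) = DeltaMod2 * formMod2 (c (X ^ k))) (φ : (ZMod 2)[X]) :
    heckeT p (formMod2 φ) = DeltaMod2 * formMod2 (c φ) := by
  induction φ using Polynomial.induction_on' with
  | add φ ψ hφ hψ => rw [formMod2_add, heckeT_add, hφ, hψ, map_add, formMod2_add, mul_add]
  | monomial n a =>
    rcases (show a = 0 ∨ a = 1 by revert a; decide) with rfl | rfl
    · simp [formMod2_zero, heckeT_zero]
    · rw [monomial_one_right_eq_X_pow, formMod2_pow, formMod2_X, h]

/-- `T_3` is, up to the factor `Δ`, the last coordinate: both sides satisfy the recurrence with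
characteristic equation `y ^ 4 = Δ y + Δ ^ 4`, the equation of `y = Δ + u`. -/
lemma heckeT_three_formMod2 (φ : (ZMod 2)[X]) :
    heckeT 3 (formMod2 φ) = DeltaMod2 * formMod2 (coord3 3 φ) := by
  refine heckeT_formMod2 _ (fun k => ?_) φ
  have hc : ∀ φ : (ZMod 2)[X], coord3 3 (X ^ 4 * φ) =
      X * coord3 3 (X * φ) + X ^ 4 * coord3 3 φ := by
    intro φ
    have h2 : (2 : (ZMod 2)[X]) = 0 := CharTwo.two_eq_zero
    rw [show X ^ 4 * φ = X * (X * (X * (X * φ))) by ring]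
    obtain ⟨a0, a1, a2, a3⟩ := coord3_X_mul φ
    obtain ⟨b0, b1, b2, b3⟩ := coord3_X_mul (X * φ)
    obtain ⟨c0, c1, c2, c3⟩ := coord3_X_mul (X * (X * φ))
    obtain ⟨d0, d1, d2, d3⟩ := coord3_X_mul (X * (X * (X * φ)))
    rw [d3, c2, c3, b1, b2, b3, a0, a1, a2, a3]
    grind
  have hv : ∀ k < 4, coord3 3 (X ^ k) = if k = 3 then 1 else 0 := by
    intro k hk
    obtain ⟨o0, o1, o2, o3⟩ := coord3_one
    have hX := coord3_X_mul 1
    rw [mul_one, o0, o1, o2, o3] at hX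
    interval_cases k <;> simp [pow_succ', coord3_X_mul, hX, o3]
  induction k using Nat.strong_induction_on with
  | _ k ih =>
    rcases lt_or_ge k 4 with hk | hk
    · rw [heckeT_three_values k (by omega), hv k hk]
      interval_cases k <;> simp [formMod2_zero, formMod2_one]
    · obtain ⟨k, rfl⟩ := Nat.exists_eq_add_of_le' hk
      rw [heckeT_three_rec, ih (k + 1) (by omega), ih k (by omega),
        show (X : (ZMod 2)[X]) ^ (k + 4) = X ^ 4 * X ^ k by ring, hc, pow_succ' X k,
        formMod2_add, formMod2_mul, formMod2_mul, formMod2_pow, formMod2_X]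
      ring

/-- `T_5` is, up to the factor `Δ`, the last coordinate: both sides satisfy the recurrence with
characteristic equation `y ^ 6 = Δ ^ 2 y ^ 4 + Δ ^ 4 y ^ 2 + Δ y + Δ ^ 6`, the equation of
`y = Δ + u`. -/
lemma heckeT_five_formMod2 (φ : (ZMod 2)[X]) :
    heckeT 5 (formMod2 φ) = DeltaMod2 * formMod2 (coord5 5 φ) := by
  refine heckeT_formMod2 _ (fun k => ?_) φ
  have hc : ∀ φ : (ZMod 2)[X], coord5 5 (X ^ 6 * φ) = X ^ 2 * coord5 5 (X ^ 4 * φ) +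
      X ^ 4 * coord5 5 (X ^ 2 * φ) + X * coord5 5 (X * φ) + X ^ 6 * coord5 5 φ := by
    intro φ
    have h2 : (2 : (ZMod 2)[X]) = 0 := CharTwo.two_eq_zero
    rw [show X ^ 6 * φ = X * (X * (X * (X * (X * (X * φ))))) by ring,
      show X ^ 4 * φ = X * (X * (X * (X * φ))) by ring, show X ^ 2 * φ = X * (X * φ) by ring]
    obtain ⟨a0, a1, a2, a3, a4, a5⟩ := coord5_X_mul φ
    obtain ⟨b0, b1, b2, b3, b4, b5⟩ := coord5_X_mul (X * φ)
    obtain ⟨c0, c1, c2, c3, c4, c5⟩ := coord5_X_mul (X * (X * φ))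
    obtain ⟨d0, d1, d2, d3, d4, d5⟩ := coord5_X_mul (X * (X * (X * φ)))
    obtain ⟨e0, e1, e2, e3, e4, e5⟩ := coord5_X_mul (X * (X * (X * (X * φ))))
    obtain ⟨f0, f1, f2, f3, f4, f5⟩ := coord5_X_mul (X * (X * (X * (X * (X * φ)))))
    rw [f5, e4, e5, d3, d4, d5, c2, c3, c4, c5, b1, b2, b3, b4, b5, a0, a1, a2, a3, a4, a5]
    grind
  have hv : ∀ k < 6, coord5 5 (X ^ k) = if k = 5 then 1 else 0 := by
    intro k hk
    obtain ⟨o0, o1, o2, o3, o4, o5⟩ := coord5_one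
    have hX := coord5_X_mul 1
    rw [mul_one, o0, o1, o2, o3, o4, o5] at hX
    interval_cases k <;> simp [pow_succ', coord5_X_mul, hX, o5]
  induction k using Nat.strong_induction_on with
  | _ k ih =>
    rcases lt_or_ge k 6 with hk | hk
    · rw [heckeT_five_values k (by omega), hv k hk]
      interval_cases k <;> simp [formMod2_zero, formMod2_one]
    · obtain ⟨k, rfl⟩ := Nat.exists_eq_add_of_le' hk
      rw [heckeT_five_rec, ih (k + 4) (by omega), ih (k + 2) (by omega), ih (k + 1) (by omega),
        ih k (by omega), show (X : (ZMod 2)[X]) ^ (k + 6) = X ^ 6 * X ^ k by ring, hc,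
        pow_succ' X k, show (X : (ZMod 2)[X]) ^ (k + 4) = X ^ 4 * X ^ k by ring,
        show (X : (ZMod 2)[X]) ^ (k + 2) = X ^ 2 * X ^ k by ring]
      simp only [formMod2_add, formMod2_mul, formMod2_pow, formMod2_X]
      ring

lemma heckeT_three_odd (φ : (ZMod 2)[X]) :
    heckeT 3 (formMod2 (X * φ ^ 2)) = formMod2 (X * coord3 1 φ ^ 2) := by
  obtain ⟨-, -, h2, h3⟩ := coord3_sq φ
  have h : coord3 3 (X * φ ^ 2) = coord3 1 φ ^ 2 := by
    rw [(coord3_X_mul _).2.2.2, h2, h3]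
    linear_combination X ^ 2 * coord3 3 φ ^ 2 * (CharTwo.two_eq_zero : (2 : (ZMod 2)[X]) = 0)
  rw [heckeT_three_formMod2, h, formMod2_mul, formMod2_X]

lemma heckeT_five_odd (φ : (ZMod 2)[X]) :
    heckeT 5 (formMod2 (X * φ ^ 2)) = formMod2 (X * coord5 2 φ ^ 2) := by
  obtain ⟨-, -, -, -, h4, h5⟩ := coord5_sq φ
  have h : coord5 5 (X * φ ^ 2) = coord5 2 φ ^ 2 := by
    rw [(coord5_X_mul _).2.2.2.2.2, h4, h5]
    linear_combination X ^ 2 * coord5 5 φ ^ 2 * (CharTwo.two_eq_zero : (2 : (ZMod 2)[X]) = 0)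
  rw [heckeT_five_formMod2, h, formMod2_mul, formMod2_X]

/-! ### Odd forms and nilpotence -/

/-- A polynomial over `𝔽₂` is the sum of an odd part `X ψ ^ 2` and an even part `ρ ^ 2`. -/
lemma exists_odd_even (P : (ZMod 2)[X]) : ∃ ψ ρ : (ZMod 2)[X], P = X * ψ ^ 2 + ρ ^ 2 ∧
    (∀ j, ψ.coeff j = P.coeff (2 * j + 1)) ∧ ∀ j, ρ.coeff j = P.coeff (2 * j) := by
  have hψ : ∀ j, (contract 2 P.divX).coeff j = P.coeff (2 * j + 1) := fun j => by
    rw [coeff_contract two_ne_zero, coeff_divX, mul_comm]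
  have hρ : ∀ j, (contract 2 P).coeff j = P.coeff (2 * j) := fun j => by
    rw [coeff_contract two_ne_zero, mul_comm]
  refine ⟨contract 2 P.divX, contract 2 P, ?_, hψ, hρ⟩
  rw [← ZMod.expand_card, ← ZMod.expand_card]
  ext n
  rw [coeff_add, coeff_expand two_pos]
  rcases Nat.even_or_odd' n with ⟨k, rfl | rfl⟩
  · rw [if_pos (dvd_mul_right 2 k), Nat.mul_div_cancel_left _ two_pos, hρ]
    rcases k with _ | k
    · simp
    · rw [show 2 * (k + 1) = 2 * k + 1 + 1 by ring, coeff_X_mul, coeff_expand two_pos,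
        if_neg (by omega), zero_add]
  · rw [if_neg (by omega), coeff_X_mul, coeff_expand two_pos, if_pos (dvd_mul_right 2 k),
      Nat.mul_div_cancel_left _ two_pos, hψ, add_zero]

lemma odd_form_add (φ ψ : (ZMod 2)[X]) :
    formMod2 (X * (φ + ψ) ^ 2) = formMod2 (X * φ ^ 2) + formMod2 (X * ψ ^ 2) := by
  rw [CharTwo.add_sq, mul_add, formMod2_add]

lemma odd_form_injective {φ ψ : (ZMod 2)[X]} (h : formMod2 (X * φ ^ 2) = formMod2 (X * ψ ^ 2)) :
    φ = ψ :=
  frobenius_inj (ZMod 2)[X] 2 (mul_left_cancel₀ X_ne_zero (formMod2_injective h))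

/-- Hecke operators preserve the space of odd forms. -/
lemma exists_heckeT_odd {p : ℕ} (hp : p.Prime) (hodd : Odd p) (φ : (ZMod 2)[X]) :
    ∃ ψ : (ZMod 2)[X], heckeT p (formMod2 (X * φ ^ 2)) = formMod2 (X * ψ ^ 2) := by
  induction φ using Polynomial.induction_on' with
  | add φ₁ φ₂ h₁ h₂ =>
    obtain ⟨ψ₁, h₁⟩ := h₁
    obtain ⟨ψ₂, h₂⟩ := h₂
    exact ⟨ψ₁ + ψ₂, by rw [odd_form_add, heckeT_add, h₁, h₂, odd_form_add]⟩
  | monomial n a =>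
    rcases (show ∀ a : ZMod 2, a = 0 ∨ a = 1 by decide) a with rfl | rfl
    · exact ⟨0, by simp [formMod2_zero, heckeT_zero]⟩
    · obtain ⟨P, hP, h⟩ := exists_heckeT_Delta_pow_mod hp hodd (2 * n + 1)
      obtain ⟨ψ, ρ, hdec, -, hρ⟩ := exists_odd_even P
      have hρ0 : ρ = 0 := by
        ext j
        rw [hρ, coeff_zero]
        by_contra hne
        -- an exponent congruent to `p (2 n + 1)` modulo `8` is odd
        have h8 := (ZMod.natCast_eq_natCast_iff' (2 * j) (p * (2 * n + 1)) 8).mp (by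
          rw [(hP _ hne).2]; push_cast; rfl)
        have : Odd (p * (2 * n + 1)) := hodd.mul (odd_two_mul_add_one n)
        rw [Nat.odd_iff] at this
        omega
      refine ⟨ψ, ?_⟩
      rw [monomial_one_right_eq_X_pow,
        show X * (X ^ n) ^ 2 = (X : (ZMod 2)[X]) ^ (2 * n + 1) by ring,
        formMod2_pow, formMod2_X, h, hdec, hρ0]
      simp

/-- A Hecke operator lowers the height of an odd form: it commutes with `T_3` and `T_5`. -/
lemma HeightLT.heckeT {p : ℕ} (hp : p.Prime) (hodd : Odd p) {n : ℕ} {φ : (ZMod 2)[X]}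
    (hφ : HeightLT (n + 1) φ) : ∃ ψ, HeightLT n ψ ∧
      heckeT p (formMod2 (X * φ ^ 2)) = formMod2 (X * ψ ^ 2) := by
  choose T hT using exists_heckeT_odd hp hodd
  have T_zero : T 0 = 0 := odd_form_injective (by simp [← hT, formMod2_zero, heckeT_zero])
  have T_one : T 1 = 0 := odd_form_injective (by
    simp [← hT, formMod2_X, formMod2_zero, heckeT_Delta hp hodd])
  refine ⟨T φ, HeightLT.map_of_commute T_zero T_one (fun φ => ?_) (fun φ => ?_) n φ hφ, hT φ⟩
  · apply odd_form_injective
    rw [← heckeT_three_odd, ← hT, ← hT, ← heckeT_three_odd, heckeT_comm Nat.prime_three hp]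
  · apply odd_form_injective
    rw [← heckeT_five_odd, ← hT, ← hT, ← heckeT_five_odd, heckeT_comm Nat.prime_five hp]

lemma HeightLT.foldr_heckeT (l : List ℕ) (hl : ∀ p ∈ l, p.Prime ∧ Odd p) :
    ∀ (n : ℕ) {φ : (ZMod 2)[X]}, HeightLT (n + l.length) φ → ∃ ψ, HeightLT n ψ ∧
      l.foldr _root_.heckeT (formMod2 (X * φ ^ 2)) = formMod2 (X * ψ ^ 2) := by
  induction l with
  | nil => exact fun n φ hφ => ⟨φ, hφ, rfl⟩
  | cons p l ih =>
    intro n φ hφ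
    obtain ⟨hp, hodd⟩ := hl p List.mem_cons_self
    obtain ⟨ψ, hψ, h⟩ := ih (fun r hr => hl r (List.mem_cons_of_mem p hr)) (n + 1) (φ := φ) (by
      rwa [List.length_cons, add_comm l.length, ← add_assoc] at hφ)
    obtain ⟨θ, hθ, h'⟩ := hψ.heckeT hp hodd
    exact ⟨θ, hθ, by rw [List.foldr_cons, h, h']⟩

lemma foldr_heckeT_add (l : List ℕ) (f g : PowerSeries (ZMod 2)) :
    l.foldr heckeT (f + g) = l.foldr heckeT f + l.foldr heckeT g := by
  induction l with
  | nil => rfl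
  | cons p l ih => rw [List.foldr_cons, ih, heckeT_add, List.foldr_cons, List.foldr_cons]

lemma foldr_heckeT_sq (l : List ℕ) (hl : ∀ p ∈ l, p.Prime ∧ Odd p) (f : PowerSeries (ZMod 2)) :
    l.foldr heckeT (f ^ 2) = l.foldr heckeT f ^ 2 := by
  induction l with
  | nil => rfl
  | cons p l ih =>
    obtain ⟨hp, hodd⟩ := hl p List.mem_cons_self
    rw [List.foldr_cons, ih fun r hr => hl r (List.mem_cons_of_mem p hr), heckeT_sq hp hodd,
      List.foldr_cons]

lemma foldr_heckeT_zero (l : List ℕ) : l.foldr heckeT 0 = 0 := by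
  induction l with
  | nil => rfl
  | cons p l ih => rw [List.foldr_cons, ih, heckeT_zero]

/-- A form of degree `d` is killed by every product of `g ≥ 1` Hecke operators as soon as `g`
exceeds the heights of all odd exponents `2 j + 1 ≤ d`. The even part of a form is a square, to
which an induction on the degree applies. -/
lemma killedByHecke_of_height_lt {g : ℕ} (hg : 0 < g) (P : (ZMod 2)[X])
    (hP : ∀ j, 2 * j + 1 ≤ P.natDegree → height j < g) : KilledByHecke (formMod2 P) g := by
  intro l hlen hl
  induction hn : P.natDegree using Nat.strong_induction_on generalizing P with
  | _ n ih =>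
    rcases Nat.eq_zero_or_pos n with rfl | hpos
    · obtain ⟨a, rfl⟩ := natDegree_eq_zero.mp hn
      have hne : l ≠ [] := by rintro rfl; simp at hlen; omega
      have hT : heckeT (l.getLast hne) (formMod2 (C a)) = 0 := by
        rcases (show ∀ a : ZMod 2, a = 0 ∨ a = 1 by decide) a with rfl | rfl
        · rw [C_0, formMod2_zero, heckeT_zero]
        · rw [C_1, formMod2_one, heckeT_one (hl _ (List.getLast_mem hne)).1]
      rw [← List.dropLast_append_getLast hne, List.foldr_append, List.foldr_cons, List.foldr_nil,
        hT, foldr_heckeT_zero]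
    · obtain ⟨ψ, ρ, hdec, hψ, hρ⟩ := exists_odd_even P
      have hρdeg : ρ.natDegree ≤ n / 2 := by
        rw [natDegree_le_iff_coeff_eq_zero]
        intro j hj
        rw [hρ]
        exact coeff_eq_zero_of_natDegree_lt (by omega)
      have h1 := ih ρ.natDegree (by omega) ρ (fun j hj => hP j (by omega)) rfl
      have hψg : HeightLT (0 + l.length) ψ := fun j hj => by
        rw [hψ] at hj
        rw [zero_add, hlen]
        exact hP j (le_natDegree_of_ne_zero hj)
      obtain ⟨θ, hθ, h2⟩ := HeightLT.foldr_heckeT l hl 0 hψg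
      rw [hdec, formMod2_add, formMod2_pow, foldr_heckeT_add, foldr_heckeT_sq l hl, h1, h2,
        hθ.eq_zero]
      simp [formMod2_zero]

end HeckeMod2

open HeckeMod2

theorem mainTheorem2 (P : Polynomial (ZMod 2)) (d : ℕ) (hP : P.natDegree = d) (hd : 1 ≤ d) :
    ∃ g : ℕ, IsNilpotenceOrder (formMod2 P) g ∧ (g : ℝ) < 3 / 2 * Real.sqrt (d : ℝ) := by
  classical
  -- the largest natural number `g₀` with `4 g₀ ^ 2 < 9 d`
  set g₀ := Nat.sqrt ((9 * d - 1) / 4) with hg₀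
  have hle : ∀ n, 4 * n ^ 2 < 9 * d ↔ n ≤ g₀ := fun n => by
    rw [hg₀, Nat.le_sqrt', Nat.le_div_iff_mul_le (by norm_num)]
    omega
  have hkill : KilledByHecke (formMod2 P) g₀ := by
    refine killedByHecke_of_height_lt ((hle 1).mp (by omega)) P fun j hj => ?_
    have := four_mul_height_add_one_sq_lt j
    exact (hle (height j + 1)).mp (by omega)
  have hex : ∃ g, KilledByHecke (formMod2 P) g := ⟨g₀, hkill⟩
  refine ⟨Nat.find hex, ⟨fun h => ?_, Nat.find_spec hex, fun n hn => Nat.find_min' hex hn⟩, ?_⟩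
  · rw [eq_zero_of_formMod2_eq_zero P h, Polynomial.natDegree_zero] at hP
    omega
  · have h : 4 * Nat.find hex ^ 2 < 9 * d := (hle _).mpr (Nat.find_min' hex hkill)
    have h' : (4 : ℝ) * (Nat.find hex : ℝ) ^ 2 < 9 * d := by exact_mod_cast h
    have : (Nat.find hex : ℝ) * (2 / 3) < Real.sqrt d := by
      apply Real.lt_sqrt_of_sq_lt
      nlinarith
    linarith
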